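/- **Setting.** Let $1\le N\le n$. Let $f(w)=\prod_{i=1}^{n+1}\frac{w-w_{a_i}}{w-w_{b_i}}$ with distinct real zeros $w_{a_1},\dots,w_{a_{n+1}}$ and poles $w_{b_k}\in\mathbb C$ that are real or pairwise conjugate (counted with multiplicity), $w_{a_i}\ne w_{b_k}$ for all $i,k$. A point $w\in\mathbb C$ is a critical point of $f$ if it is one for $f$ as a map to the Riemann sphere: $f'(w)=0$, or, at a pole, $(1/f)'(w)=0$. Let $w_{u_{2k-1}}$ and $w_{v_{2k}}=\overline{w_{u_{2k-1}}}$, $1\le k\le N$, be critical points of $f$, all $2N$ of them distinct. Let $\theta\in\mathbb R$ and $\hat d\in\mathbb C^{2N}$ with $\overline{\hat d_{2k}}=\hat d_{2k-1}$. For $1\le j\le n$ put $$s_j=\operatorname{sign}\bigl(f'(w_{a_{n+1}})f'(w_{a_j})\bigr),\qquad q_2(a_{n+1},a_j)=\frac{1}{f'(w_{a_{n+1}})f'(w_{a_j})(w_{a_{n+1}}-w_{a_j})^2},\qquad A_j=|q_2(a_{n+1},a_j)|^{1/2},$$ $$E_j=\frac1{f'(w_{a_{n+1}})(w_{a_j}-w_{a_{n+1}})},\qquad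 F_j=-E_j^2+2\sum_{k=1}^nq_2(a_{n+1},a_k),$$ and for $1\le k\le N$ $$\hat V_{2k-1}=\frac1{f'(w_{a_{n+1}})(w_{a_{n+1}}-w_{u_{2k-1}})^2},\quad \hat W_{2k-1}=\frac{-2}{f'(w_{a_{n+1}})^2(w_{a_{n+1}}-w_{u_{2k-1}})^3},\quad \hat r_{j,2k-1}=-\frac{w_{a_{n+1}}-w_{a_j}}{(w_{a_{n+1}}-w_{u_{2k-1}})(w_{a_j}-w_{u_{2k-1}})},$$ $\hat V_{2k}=-\overline{\hat V_{2k-1}}$, $\hat W_{2k}=-\overline{\hat W_{2k-1}}$, $\hat r_{j,2k}=-\overline{\hat r_{j,2k-1}}$, and $z_k=\mathrm i\hat V_kx+\mathrm i\hat W_kt-\hat d_k$ for $1\le k\le 2N$. For $\beta\in\{0,1\}$ let $\mathbb K_{j,\beta}$ be the $2N\times2N$ matrix with diagonal entries $-(z_k+\beta\hat r_{j,k})$ and off-diagonal entries $\frac1{w_{v_i}-w_{v_k}}$ ($i,k$ even), $\frac1{w_{v_i}-w_{u_k}}$ ($i$ even, $k$ odd), $-\frac1{w_{u_i}-w_{v_k}}$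 ($i$ odd, $k$ even), $-\frac1{w_{u_i}-w_{u_k}}$ ($i,k$ odd). Put $$\psi_j(x,t)=A_j\,e^{\mathrm i\theta}\,\frac{\det\mathbb K_{j,1}}{\det\mathbb K_{j,0}}\,e^{\mathrm i(-E_jx+F_jt)}\qquad(1\le j\le n,\ x,t\in\mathbb R).$$ **Definitions.** $n$-NLS$^s$, $s_k=\pm1$, is the system $\mathrm i\,\partial_t\psi_j+\partial_x^2\psi_j+2\bigl(\sum_{k=1}^ns_k|\psi_k|^2\bigr)\psi_j=0$, $1\le j\le n$. An *$N$-rational breather* of it is a solution $(\psi_1,\dots,\psi_n)$, smooth on $\mathbb R^2$, such that (a) $\psi_j=\frac{P_j(x,t)}{Q(x,t)}e^{\mathrm i(-E_jx+F_jt)}$ with real $E_j,F_j$ and complex polynomials $P_j,Q$ of total degree $2N$, where $Q$ has no zero on $\mathbb R^2$; (b) it is isolated in space and time: for each $j$, $|\psi_j(x,t)|$ tends to a positive constant as $(x,t)\to\infty$ in $\mathbb R^2$; (c) for no $j$ is $|\psi_j|$ periodic in $x$ or in $t$. A function $\varphi(x,t)$ has the *Peregrine profile* if $|\varphi(x,t)|=c\,|\mathcal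 P(L(x,t))|$ for some $c>0$ and some invertible real affine map $L$ of $\mathbb R^2$, where $\mathcal P(x,t)=\Bigl(1-\frac{4(1+4\mathrm it)}{1+4x^2+16t^2}\Bigr)e^{2\mathrm it}$. **Proposition.** 1. For every $1\le N\le n$ and every choice of the data above: a point $w\in\mathbb C$ different from all $w_{a_i}$ is a critical point of $f$ if and only if $\sum_{i=1}^{n+1}\frac{1}{f'(w_{a_i})}\frac1{(w-w_{a_i})^2}=0$; $\det\mathbb K_{j,0}\neq0$ for all $j$ and all $x,t\in\mathbb R$; and $(\psi_1,\dots,\psi_n)$ is an $N$-rational breather of $n$-NLS$^s$. 2. In the scalar case $n=N=1$ one has $s_1=1$ and $\psi_1$ always has the Peregrine profile. 3. In the multi-component case there are new profiles: for some $n\ge2$, $N=1$, some choice of the data and some $j$, the component $\psi_j$ does not have the Peregrine profile. -/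

import Mathlib

open scoped ContDiff ComplexConjugate

noncomputable section

/-- The multi-component nonlinear Schrödinger equation `n-NLS^s`, satisfied at every point
`(x, t)` of the plane:
`i ∂ψ_j/∂t + ∂²ψ_j/∂x² + 2 (∑ k, s_k |ψ_k|²) ψ_j = 0` for `j = 1, …, n`. -/
def SolvesNLS {n : ℕ} (s : Fin n → ℝ) (ψ : Fin n → ℝ → ℝ → ℂ) : Prop :=
  ∀ (j : Fin n) (x t : ℝ),
    Complex.I * deriv (fun t' : ℝ => ψ j x t') t
      + iteratedDeriv 2 (fun x' : ℝ => ψ j x' t) x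
      + 2 * ((∑ k, s k * ‖ψ k x t‖ ^ 2 : ℝ) : ℂ) * ψ j x t = 0

/-- `ψ` is an `N`-rational breather of `n-NLS^s` (`s_k = ±1`): a smooth solution on the whole
`(x, t)`-plane, all of whose components are, up to a plane wave factor, quotients of polynomials
of degree `2N` in `x` and `t` with a common zero-free denominator; it is isolated in space and
time (the modulus of every component tends to a positive constant background at infinity of the
`(x, t)`-plane), and the modulus of no component is periodic in `x` or in `t`. -/
structure IsRationalBreather {n : ℕ} (N : ℕ) (s : Fin n → ℝ) (ψ : Fin n → ℝ → ℝ → ℂ) :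
    Prop where
  sign : ∀ k, s k = 1 ∨ s k = -1
  smooth : ∀ j, ContDiff ℝ ∞ (fun p : ℝ × ℝ => ψ j p.1 p.2)
  solves : SolvesNLS s ψ
  rational : ∃ (Q : MvPolynomial (Fin 2) ℂ) (P : Fin n → MvPolynomial (Fin 2) ℂ)
      (E F : Fin n → ℝ),
    Q.totalDegree = 2 * N ∧ (∀ j, (P j).totalDegree = 2 * N) ∧
    (∀ x t : ℝ, MvPolynomial.eval ![(x : ℂ), (t : ℂ)] Q ≠ 0) ∧
    ∀ (j : Fin n) (x t : ℝ),
      ψ j x t = MvPolynomial.eval ![(x : ℂ), (t : ℂ)] (P j)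
        / MvPolynomial.eval ![(x : ℂ), (t : ℂ)] Q
        * Complex.exp (Complex.I * (-(E j : ℂ) * x + (F j : ℂ) * t))
  isolated : ∀ j, ∃ A : ℝ, 0 < A ∧
    Filter.Tendsto (fun p : ℝ × ℝ => ‖ψ j p.1 p.2‖) (Filter.cocompact (ℝ × ℝ)) (nhds A)
  not_periodic_space : ∀ j, ∀ T : ℝ, T ≠ 0 → ¬ ∀ x t : ℝ, ‖ψ j (x + T) t‖ = ‖ψ j x t‖
  not_periodic_time : ∀ j, ∀ T : ℝ, T ≠ 0 → ¬ ∀ x t : ℝ, ‖ψ j x (t + T)‖ = ‖ψ j x t‖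

/-- The function `f(w) = ∏ i, (w - a_i) / (w - b_i)` (as a function on `ℂ`, with the value `0`
at the poles `b_i`). -/
def rationalMap {m : ℕ} (a : Fin m → ℝ) (b : Fin m → ℂ) (w : ℂ) : ℂ :=
  ∏ i, (w - (a i : ℂ)) / (w - b i)

/-- `w ∈ ℂ` is a critical point of the meromorphic function `f = ∏ i, (w - a_i) / (w - b_i)` on
the sphere: `f'(w) = 0` if `w` is not a pole; at a pole the local coordinate `1/f` of the target
sphere is used (the junk value `f = 0` at a pole makes `1/f = 0` there, which is its right
value). -/
def IsCriticalPoint {m : ℕ} (a : Fin m → ℝ) (b : Fin m → ℂ) (w : ℂ) : Prop :=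
  ((∀ i, w ≠ b i) ∧ deriv (rationalMap a b) w = 0) ∨
  ((∃ i, w = b i) ∧ deriv (fun z => (rationalMap a b z)⁻¹) w = 0)

/-- The parameters of the construction.  The zero `w_{a_{n+1}}` is `a (Fin.last n)`, and
`w_{a_j}`, `1 ≤ j ≤ n`, is `a j.castSucc`.  The poles are real or pairwise conjugate (with
multiplicity).  `u k` is the critical point `w_{u_{2k-1}}`, its conjugate is `w_{v_{2k}}`, and
these `2N` critical points are distinct. `d k` is the parameter with index `2k-1`, its conjugate
is the one with index `2k`. -/
structure BreatherData (n N : ℕ) where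
  /-- the real zeros of `f` -/
  a : Fin (n + 1) → ℝ
  /-- the poles of `f` -/
  b : Fin (n + 1) → ℂ
  a_injective : Function.Injective a
  a_ne_b : ∀ i k, (a i : ℂ) ≠ b k
  poles_conj : ∃ σ : Equiv.Perm (Fin (n + 1)), ∀ i, conj (b i) = b (σ i)
  /-- the real phase -/
  θ : ℝ
  /-- the complex parameters with odd index -/
  d : Fin N → ℂ
  /-- the critical points -/
  u : Fin N → ℂ
  u_critical : ∀ k, IsCriticalPoint a b (u k)
  uv_injective : Function.Injective (Sum.elim u fun k => conj (u k))

namespace BreatherData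

variable {n N : ℕ} (D : BreatherData n N)

/-- The real meromorphic function `f`. -/
def f : ℂ → ℂ := rationalMap D.a D.b

/-- `f'(w_{a_i})`. -/
def df (i : Fin (n + 1)) : ℂ := deriv D.f (D.a i)

/-- The distinguished zero `w_{a_{n+1}}`. -/
def aLast : ℂ := D.a (Fin.last n)

/-- The zero `w_{a_j}`, `1 ≤ j ≤ n`. -/
def aj (j : Fin n) : ℂ := D.a j.castSucc

/-- `w_{v_{2k}}`, the conjugate of `w_{u_{2k-1}}`. -/
def v (k : Fin N) : ℂ := conj (D.u k)

/-- `s_j = sign (f'(w_{a_{n+1}}) f'(w_{a_j}))`; the product is a real number. -/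
def s (j : Fin n) : ℝ := Real.sign (D.df (Fin.last n) * D.df j.castSucc).re

/-- `q₂(a_{n+1}, a_j)`. -/
def q₂ (j : Fin n) : ℂ :=
  1 / (D.df (Fin.last n) * D.df j.castSucc * (D.aLast - D.aj j) ^ 2)

/-- `A_j = |q₂(a_{n+1}, a_j)|^{1/2}`. -/
def A (j : Fin n) : ℝ := Real.sqrt ‖D.q₂ j‖

/-- `E_j`. -/
def E (j : Fin n) : ℂ := 1 / (D.df (Fin.last n) * (D.aj j - D.aLast))

/-- `F_j`. -/
def F (j : Fin n) : ℂ := -(D.E j) ^ 2 + 2 * ∑ k, D.q₂ k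

/-!
The index set `{1, …, 2N}` is modelled by `Fin N ⊕ Fin N`: `Sum.inl k` is the odd index `2k-1`
and `Sum.inr k` is the even index `2k` (of the `k`-th pair).
-/

/-- The numbers `V̂_{a_{n+1}, k}`. -/
def V : Fin N ⊕ Fin N → ℂ
  | Sum.inl k => 1 / D.df (Fin.last n) * (1 / (D.aLast - D.u k) ^ 2)
  | Sum.inr k => -conj (1 / D.df (Fin.last n) * (1 / (D.aLast - D.u k) ^ 2))

/-- The numbers `Ŵ_{a_{n+1}, k}`. -/
def W : Fin N ⊕ Fin N → ℂ
  | Sum.inl k => -(1 / D.df (Fin.last n) ^ 2 * (2 / (D.aLast - D.u k) ^ 3))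
  | Sum.inr k => -conj (-(1 / D.df (Fin.last n) ^ 2 * (2 / (D.aLast - D.u k) ^ 3)))

/-- The numbers `r̂_{j, k}`. -/
def r (j : Fin n) : Fin N ⊕ Fin N → ℂ
  | Sum.inl k => -((D.aLast - D.aj j) / ((D.aLast - D.u k) * (D.aj j - D.u k)))
  | Sum.inr k => -conj (-((D.aLast - D.aj j) / ((D.aLast - D.u k) * (D.aj j - D.u k))))

/-- The numbers `d̂_k`. -/
def dHat : Fin N ⊕ Fin N → ℂ
  | Sum.inl k => D.d k
  | Sum.inr k => conj (D.d k)

/-- The linear functions `z_k` of `x` and `t`. -/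
def z (k : Fin N ⊕ Fin N) (x t : ℝ) : ℂ :=
  Complex.I * D.V k * x + Complex.I * D.W k * t - D.dHat k

/-- The `2N × 2N` matrix `𝕂_{j,β}` at the point `(x, t)`. -/
def K (j : Fin n) (β : ℂ) (x t : ℝ) : Matrix (Fin N ⊕ Fin N) (Fin N ⊕ Fin N) ℂ :=
  Matrix.fromBlocks
    (Matrix.of fun i k => if i = k then -(D.z (Sum.inl k) x t + β * D.r j (Sum.inl k))
      else -(1 / (D.u i - D.u k)))
    (Matrix.of fun i k => -(1 / (D.u i - D.v k)))
    (Matrix.of fun i k => 1 / (D.v i - D.u k))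
    (Matrix.of fun i k => if i = k then -(D.z (Sum.inr k) x t + β * D.r j (Sum.inr k))
      else 1 / (D.v i - D.v k))

/-- The functions `ψ_j`. -/
def ψ (j : Fin n) (x t : ℝ) : ℂ :=
  (D.A j : ℂ) * Complex.exp (Complex.I * D.θ) * ((D.K j 1 x t).det / (D.K j 0 x t).det)
    * Complex.exp (Complex.I * (-(D.E j) * x + D.F j * t))

end BreatherData

/-- The Peregrine breather `(1 - 4 (1 + 4 i t) / (1 + 4 x² + 16 t²)) exp (2 i t)` of the focusing
equation `i ψ_t + ψ_xx + 2 |ψ|² ψ = 0`. -/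
def peregrine (x t : ℝ) : ℂ :=
  (1 - 4 * (1 + 4 * Complex.I * t) / (1 + 4 * (x : ℂ) ^ 2 + 16 * (t : ℂ) ^ 2))
    * Complex.exp (2 * Complex.I * t)

/-- The profile (modulus) of `φ` is that of the Peregrine breather, up to a positive amplitude
factor and an invertible real affine change of the variables `(x, t)`. -/
def HasPeregrineProfile (φ : ℝ → ℝ → ℂ) : Prop :=
  ∃ (c : ℝ) (L : (ℝ × ℝ) ≃ᵃ[ℝ] (ℝ × ℝ)), 0 < c ∧
    ∀ x t : ℝ, ‖φ x t‖ = c * ‖peregrine (L (x, t)).1 (L (x, t)).2‖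

end

/-! Up to the sign of its odd rows, `K j β` is a Calogero–Moser matrix: its nodes `w` are the 2N
critical points, its diagonal is affine in (x, t), and β adds the difference of the pole vectors ℓ_j
= 1/(w - a_j) and p = 1/(w - a_{n+1}). Write G for the case β = 0, R = diag(p), Y = G⁻¹ and c for
the residue of 1/f at a_{n+1}. The ratio of determinants is then φ_j = 1 + (a_j - a_{n+1}) ℓ_jᵀ Y p,
with ∂ₓG = i c R² and ∂ₜG = 2i c² R³.

Everything algebraic follows from the rank one commutator GR - RG = p pᵀ - R²
(`cmMatrix_commutator`). It gives a linear Schrödinger equation for φ_j whose potential is a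
multiple of pᵀYR²Yp (`wave_lax`). Since conjugation turns φ_j into the adjoint wave function, it
also writes |φ_j|² - 1 as a multiple of ℓ_jᵀYR²Yℓ_j (`wave_mul_adjoint_wave`). The critical point
equation makes a trace vanish (`sum_poleVec_sq_eq_zero`), so the potential is the weighted sum of
the |φ_k|² - 1: the linear equation becomes NLS.

Smoothness needs det G ≠ 0 on the whole plane. A kernel vector of G would annihilate a sum of two
forms built on the kernel i/(w - w̄') of the upper half-plane, which is positive definite for
distinct nodes. At infinity the diagonal dominates and φ_j tends to 1, so a period would force |φ_j|
≡ 1, which the leading terms exclude.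

For n = N = 1 the two zeros are seen from the critical point under a right angle; this fixes the
sign and the one invariant of the profile. With three zeros the invariant can be so small that the
component never vanishes, whereas Peregrine's breather has zeros. -/

noncomputable section

open Matrix

/-! ### Algebra of Calogero–Moser matrices -/

section CalogeroMoser

variable {ι : Type*} [Fintype ι] [DecidableEq ι]

/-- The Calogero–Moser matrix with diagonal `g` and off-diagonal entries `1 / (w i - w k)`. -/
def cmMatrix (w g : ι → ℂ) : Matrix ι ι ℂ :=
  Matrix.of fun i k => if i = k then g i else 1 / (w i - w k)

/-- The vector of the numbers `1 / (w i - b)`. -/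
def poleVec (w : ι → ℂ) (b : ℂ) (i : ι) : ℂ := 1 / (w i - b)

omit [Fintype ι] in
theorem cmMatrix_transpose (w g : ι → ℂ) : (cmMatrix w g)ᵀ = -cmMatrix w (-g) := by
  ext i k
  by_cases h : i = k
  · subst h; simp [cmMatrix]
  · have h' : ¬ k = i := fun e => h e.symm
    simp only [cmMatrix, transpose_apply, of_apply, Matrix.neg_apply, h, h', if_false]
    rw [← neg_sub (w i) (w k), div_neg]

omit [Fintype ι] in
theorem cmMatrix_add (w g h : ι → ℂ) : cmMatrix w (g + h) = cmMatrix w g + diagonal h := by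
  ext i k
  by_cases e : i = k
  · subst e; simp [cmMatrix]
  · simp [cmMatrix, e]

/-- Off the diagonal, 1/(w_k - b) - 1/(w_i - b) contains the factor w_i - w_k, which cancels the
denominator of the matrix entry and leaves a product. This rank one structure drives all later
identities. -/
theorem cmMatrix_commutator {w : ι → ℂ} (hw : Function.Injective w) (g : ι → ℂ) {b : ℂ}
    (hb : ∀ i, w i ≠ b) :
    cmMatrix w g * diagonal (poleVec w b) - diagonal (poleVec w b) * cmMatrix w g
      = vecMulVec (poleVec w b) (poleVec w b)
        - diagonal (poleVec w b) * diagonal (poleVec w b) := by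
  ext i k
  have h1 := sub_ne_zero.2 (hb i)
  have h2 := sub_ne_zero.2 (hb k)
  by_cases e : i = k
  · subst e
    simp [cmMatrix, vecMulVec_apply, mul_comm]
  · have h3 := sub_ne_zero.2 (fun q => e (hw q))
    simp only [Matrix.sub_apply, mul_diagonal, diagonal_mul, cmMatrix, of_apply, e, if_false, poleVec,
      vecMulVec_apply, ne_eq, not_false_eq_true, diagonal_apply_ne]
    field_simp
    ring

/-- Conjugation by the diagonal matrix of the (w_i - a)/(w_i - b) turns the shift of the diagonal
into a rank one perturbation, to which the matrix determinant lemma applies. -/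
theorem det_cmMatrix_add_poleVec {w : ι → ℂ} (hw : Function.Injective w) (g : ι → ℂ) {a b : ℂ}
    (ha : ∀ i, w i ≠ a) (hb : ∀ i, w i ≠ b) (hG : (cmMatrix w g).det ≠ 0) :
    (cmMatrix w (g + (poleVec w b - poleVec w a))).det
      = (cmMatrix w g).det
        * (1 + (b - a) * (poleVec w b ⬝ᵥ (cmMatrix w g)⁻¹ *ᵥ poleVec w a)) := by
  set S : Matrix ι ι ℂ := diagonal fun i => (w i - a) / (w i - b) with hS
  have hSd : S.det ≠ 0 := by
    rw [hS, det_diagonal]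
    exact Finset.prod_ne_zero_iff.2 fun i _ =>
      div_ne_zero (sub_ne_zero.2 (ha i)) (sub_ne_zero.2 (hb i))
  have key : cmMatrix w (g + (poleVec w b - poleVec w a)) * S
      = S * (cmMatrix w g + vecMulVec (poleVec w a) ((b - a) • poleVec w b)) := by
    ext i k
    have h1 := sub_ne_zero.2 (hb i)
    have h2 := sub_ne_zero.2 (hb k)
    have h3 := sub_ne_zero.2 (ha i)
    have h4 := sub_ne_zero.2 (ha k)
    by_cases e : i = k
    · subst e
      simp only [hS, mul_diagonal, diagonal_mul, cmMatrix, of_apply, if_true, poleVec, Matrix.add_apply,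
        vecMulVec_apply, Pi.add_apply, Pi.sub_apply, Pi.smul_apply, smul_eq_mul]
      field_simp
      ring
    · have h5 := sub_ne_zero.2 (fun q => e (hw q))
      simp only [hS, mul_diagonal, diagonal_mul, cmMatrix, of_apply, e, if_false, poleVec,
        Matrix.add_apply, vecMulVec_apply, Pi.smul_apply, smul_eq_mul]
      field_simp
      ring
  have h := congrArg det key
  rw [det_mul, det_mul, mul_comm] at h
  have h' := mul_left_cancel₀ hSd h
  rw [h', vecMulVec_eq Unit, det_add_replicateCol_mul_replicateRow hG.isUnit]
  congr 1
  rw [dotProduct_mulVec, ← smul_eq_mul, ← smul_dotProduct, ← smul_vecMul]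
  simp [Matrix.mul_apply, dotProduct, vecMul, Finset.mul_sum, Finset.sum_mul, mul_assoc]

variable {w g : ι → ℂ} (hw : Function.Injective w) (hG : (cmMatrix w g).det ≠ 0)
include hw hG

/-- The commutator relation multiplied by G⁻¹ on both sides. It trades two inverses around R² for
terms with a single inverse plus a rank one term. -/
theorem inv_cmMatrix_conj {b : ℂ} (hb : ∀ i, w i ≠ b) :
    (cmMatrix w g)⁻¹ * (diagonal (poleVec w b) * diagonal (poleVec w b)) * (cmMatrix w g)⁻¹
      = (cmMatrix w g)⁻¹ * diagonal (poleVec w b) - diagonal (poleVec w b) * (cmMatrix w g)⁻¹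
        + (cmMatrix w g)⁻¹ * vecMulVec (poleVec w b) (poleVec w b) * (cmMatrix w g)⁻¹ := by
  have h := cmMatrix_commutator hw g hb
  set G := cmMatrix w g
  set R := diagonal (poleVec w b)
  have h1 : G⁻¹ * G = 1 := nonsing_inv_mul _ hG.isUnit
  have h2 : G * G⁻¹ = 1 := mul_nonsing_inv _ hG.isUnit
  have h3 : R * R = vecMulVec (poleVec w b) (poleVec w b) - (G * R - R * G) := by
    rw [h]; abel
  rw [h3]
  have e1 : G⁻¹ * (G * R) * G⁻¹ = R * G⁻¹ := by rw [← mul_assoc, h1, one_mul]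
  have e2 : G⁻¹ * (R * G) * G⁻¹ = G⁻¹ * R := by rw [mul_assoc, mul_assoc, h2, mul_one]
  rw [mul_sub, sub_mul, mul_sub, sub_mul, e1, e2]
  abel

omit hw hG in
theorem diagonal_poleVec_mulVec {a b : ℂ} (hab : a ≠ b) (ha : ∀ i, w i ≠ a)
    (hb : ∀ i, w i ≠ b) :
    diagonal (poleVec w a) *ᵥ poleVec w b
      = (b - a)⁻¹ • (poleVec w b - poleVec w a) := by
  ext i
  have h1 := sub_ne_zero.2 (hb i)
  have h3 := sub_ne_zero.2 (ha i)
  have h4 := sub_ne_zero.2 hab.symm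
  simp only [mulVec_diagonal, poleVec, Pi.smul_apply, Pi.sub_apply, smul_eq_mul]
  field_simp
  ring

/-- Quadratic relation between the two wave functions and the poleVec. -/
theorem wave_mul_adjoint_wave {a b : ℂ} (hab : a ≠ b) (ha : ∀ i, w i ≠ a) (hb : ∀ i, w i ≠ b) :
    (1 + (b - a) * (poleVec w b ⬝ᵥ (cmMatrix w g)⁻¹ *ᵥ poleVec w a))
      * (1 - (b - a) * (poleVec w a ⬝ᵥ (cmMatrix w g)⁻¹ *ᵥ poleVec w b)) - 1
    = -((b - a) ^ 2 * (poleVec w b ⬝ᵥ ((cmMatrix w g)⁻¹ *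
        (diagonal (poleVec w a) * diagonal (poleVec w a)) * (cmMatrix w g)⁻¹)
          *ᵥ poleVec w b)) := by
  have h4 := sub_ne_zero.2 hab.symm
  have hv : poleVec w b ᵥ* diagonal (poleVec w a)
      = (b - a)⁻¹ • (poleVec w b - poleVec w a) := by
    rw [← diagonal_poleVec_mulVec hab ha hb]
    ext i; simp [mulVec_diagonal, vecMul_diagonal, mul_comm]
  rw [inv_cmMatrix_conj hw hG ha]
  simp only [add_mulVec, sub_mulVec, dotProduct_add, dotProduct_sub, ← mulVec_mulVec,
    diagonal_poleVec_mulVec hab ha hb, vecMulVec_mulVec]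
  rw [dotProduct_mulVec _ (diagonal _), hv]
  simp only [mulVec_smul, mulVec_sub, dotProduct_smul, dotProduct_sub, smul_dotProduct,
    sub_dotProduct, smul_eq_mul, op_smul_eq_smul]
  field_simp
  ring

/-- The scalar Lax equation behind the nonlinear Schrödinger equation. -/
theorem wave_lax {a b : ℂ} (hab : a ≠ b) (ha : ∀ i, w i ≠ a) (hb : ∀ i, w i ≠ b)
    {R Y : Matrix ι ι ℂ} (hR : R = diagonal (poleVec w a)) (hY : Y = (cmMatrix w g)⁻¹) :
    (b - a) * (poleVec w b ⬝ᵥ (Y * (R * R * R) * Y) *ᵥ poleVec w a)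
      - poleVec w b ⬝ᵥ (Y * (R * R) * Y) *ᵥ poleVec w a
      - (b - a) * (poleVec w b ⬝ᵥ (Y * (R * R) * Y * (R * R) * Y) *ᵥ poleVec w a)
    = -((1 + (b - a) * (poleVec w b ⬝ᵥ Y *ᵥ poleVec w a))
        * (poleVec w a ⬝ᵥ (Y * (R * R) * Y) *ᵥ poleVec w a)) := by
  have h4 := sub_ne_zero.2 hab.symm
  have hv : poleVec w b ᵥ* R = (b - a)⁻¹ • (poleVec w b - poleVec w a) := by
    rw [hR, ← diagonal_poleVec_mulVec hab ha hb]
    ext i; simp [mulVec_diagonal, vecMul_diagonal, mul_comm]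
  have hc := inv_cmMatrix_conj hw hG ha
  rw [← hR, ← hY] at hc
  -- Only the first factor YR²Y is rewritten by `hc`. The R left in front is then absorbed into the
  -- left vector by partial fractions (`hv`), and the rank one term yields the product on the
  -- right-hand side.
  have e : Y * (R * R) * Y * (R * R) * Y = Y * (R * R * R) * Y - R * (Y * (R * R) * Y)
      + Y * vecMulVec (poleVec w a) (poleVec w a) * (Y * (R * R) * Y) := by
    have : Y * (R * R) * Y * (R * R) * Y = (Y * (R * R) * Y) * ((R * R) * Y) := by noncomm_ring
    rw [this]
    nth_rewrite 1 [hc]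
    noncomm_ring

  rw [e]
  simp only [add_mulVec, sub_mulVec, dotProduct_add, dotProduct_sub]
  rw [← mulVec_mulVec _ R, dotProduct_mulVec _ R, hv, ← mulVec_mulVec _ (Y * vecMulVec _ _),
    ← mulVec_mulVec _ Y (vecMulVec _ _), vecMulVec_mulVec]
  simp only [mulVec_smul, dotProduct_smul, smul_dotProduct,
    sub_dotProduct, smul_eq_mul, op_smul_eq_smul]
  field_simp
  ring

/-- The critical point relation yields an identity for the squares of the wave functions. -/
theorem sum_poleVec_sq_eq_zero {κ : Type*} [Fintype κ] (c b : κ → ℂ)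
    (hb : ∀ m i, w i ≠ b m) (hc : ∀ i, ∑ m, c m * (1 / (w i - b m) ^ 2) = 0) (r : ι → ℂ) :
    ∑ m, c m * (poleVec w (b m) ⬝ᵥ
      ((cmMatrix w g)⁻¹ * (diagonal r * diagonal r) * (cmMatrix w g)⁻¹) *ᵥ poleVec w (b m))
      = 0 := by
  set G := cmMatrix w g with hGdef
  set D := diagonal r * diagonal r with hD
  have h1 : G⁻¹ * G = 1 := nonsing_inv_mul _ hG.isUnit
  have h2 : G * G⁻¹ = 1 := mul_nonsing_inv _ hG.isUnit
  set T : Matrix ι ι ℂ := ∑ m, c m • diagonal (poleVec w (b m)) with hT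
  -- In the weighted sum of the commutator relations the squared diagonals cancel by `hc`, so the
  -- weighted rank one matrices add up to [G, T] with T diagonal. The claim becomes tr(G⁻¹DG⁻¹[G,
  -- T]) = 0, which holds because T and D commute.
  have hrank : ∑ m, c m • vecMulVec (poleVec w (b m)) (poleVec w (b m)) = G * T - T * G := by
    have e : ∀ m, vecMulVec (poleVec w (b m)) (poleVec w (b m))
        = (G * diagonal (poleVec w (b m)) - diagonal (poleVec w (b m)) * G)
          + diagonal (poleVec w (b m)) * diagonal (poleVec w (b m)) := by
      intro m
      rw [cmMatrix_commutator hw g (hb m)]; abel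
    have z : ∑ m, c m • (diagonal (poleVec w (b m)) * diagonal (poleVec w (b m))) = 0 := by
      ext i k
      by_cases h : i = k
      · subst h
        rw [Matrix.sum_apply, Matrix.zero_apply, ← hc i]
        refine Finset.sum_congr rfl fun m _ => ?_
        simp only [diagonal_mul_diagonal, Matrix.smul_apply, diagonal_apply_eq, poleVec, smul_eq_mul]
        rw [← _root_.one_div_pow]
        ring
      · rw [Matrix.sum_apply]
        simp [h]
    simp_rw [e, smul_add, Finset.sum_add_distrib, z, add_zero, smul_sub, Finset.sum_sub_distrib]
    rw [hT, Finset.mul_sum, Finset.sum_mul]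
    simp
  have htr : ∀ v : ι → ℂ, v ⬝ᵥ (G⁻¹ * D * G⁻¹) *ᵥ v = (G⁻¹ * D * G⁻¹ * vecMulVec v v).trace := by
    intro v
    rw [mul_vecMulVec, trace_vecMulVec, dotProduct_comm]
  simp_rw [htr]
  have : ∑ m, c m * (G⁻¹ * D * G⁻¹ * vecMulVec (poleVec w (b m)) (poleVec w (b m))).trace
      = (G⁻¹ * D * G⁻¹ * (G * T - T * G)).trace := by
    rw [← hrank, Finset.mul_sum, trace_sum]
    simp
  rw [this, mul_sub, trace_sub]
  have hcomm : T * D = D * T := by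
    rw [hT, Finset.sum_mul, Finset.mul_sum]
    refine Finset.sum_congr rfl fun m _ => ?_
    simp only [hD, smul_mul_assoc, mul_smul_comm, diagonal_mul_diagonal]
    congr 2
    ext i
    ring
  have e1 : G⁻¹ * D * G⁻¹ * (G * T) = G⁻¹ * (D * T) := by
    rw [mul_assoc _ G⁻¹, ← mul_assoc G⁻¹ G, h1, one_mul, mul_assoc]
  have e2 : (G⁻¹ * D * G⁻¹ * (T * G)).trace = (G⁻¹ * (T * D)).trace := by
    rw [← mul_assoc, trace_mul_comm, ← mul_assoc, ← mul_assoc, ← mul_assoc, h2, one_mul,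
      mul_assoc, trace_mul_comm, mul_assoc]
  rw [e1, e2, hcomm, sub_self]

end CalogeroMoser

/-! ### Positivity of the Cauchy kernel and non-degeneracy -/

section CauchyKernel

variable {ι : Type*}

theorem norm_cayley_lt_one {z : ℂ} (hz : 0 < z.im) : ‖(z - Complex.I) / (z + Complex.I)‖ < 1 := by
  have h0 : z + Complex.I ≠ 0 := fun h => by
    have := congrArg Complex.im h
    simp at this
    linarith
  rw [norm_div, div_lt_one (norm_pos_iff.2 h0), ← sq_lt_sq₀ (norm_nonneg _) (norm_nonneg _),
    ← Complex.normSq_eq_norm_sq, ← Complex.normSq_eq_norm_sq, Complex.normSq_apply,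
    Complex.normSq_apply]
  simp
  nlinarith

/-- The Cauchy kernel of the upper half-plane as a sum of squares. -/
theorem hasSum_cauchyKernel (T : Finset ι) (w c : ι → ℂ) (hT : ∀ i ∈ T, 0 < (w i).im) :
    HasSum (fun m : ℕ => 2 * ‖∑ i ∈ T, c i / (w i + Complex.I)
        * ((w i - Complex.I) / (w i + Complex.I)) ^ m‖ ^ 2)
      (∑ i ∈ T, ∑ k ∈ T, c i * conj (c k) * (Complex.I / (w i - conj (w k)))).re := by
  have hne : ∀ i ∈ T, w i + Complex.I ≠ 0 := fun i hi h => by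
    have := congrArg Complex.im h
    have := hT i hi
    simp at *
    linarith
  -- With q(w) = (w - i)/(w + i), of modulus below 1, 1 - q(w) q̄(v) is a multiple of w - v̄. The
  -- kernel is therefore a geometric series in q(w) q̄(v).
  have key : ∀ i ∈ T, ∀ k ∈ T, HasSum (fun m : ℕ =>
      2 * ((c i / (w i + Complex.I) * ((w i - Complex.I) / (w i + Complex.I)) ^ m)
        * conj (c k / (w k + Complex.I) * ((w k - Complex.I) / (w k + Complex.I)) ^ m)))
      (c i * conj (c k) * (Complex.I / (w i - conj (w k)))) := by
    intro i hi k hk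
    have h1 := hne i hi
    have h2 : conj (w k) - Complex.I ≠ 0 := by
      have := (map_ne_zero (starRingEnd ℂ)).2 (hne k hk)
      simpa [sub_eq_add_neg] using this
    have h3 : w i - conj (w k) ≠ 0 := fun h => by
      have h' := congrArg Complex.im h
      simp at h'
      linarith [hT i hi, hT k hk]
    have hq : ‖(w i - Complex.I) / (w i + Complex.I)
        * conj ((w k - Complex.I) / (w k + Complex.I))‖ < 1 := by
      rw [norm_mul, RCLike.norm_conj]
      exact mul_lt_one_of_nonneg_of_lt_one_left (norm_nonneg _) (norm_cayley_lt_one (hT i hi))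
        (norm_cayley_lt_one (hT k hk)).le
    have hg := (hasSum_geometric_of_norm_lt_one hq).mul_left
      (2 * (c i / (w i + Complex.I) * conj (c k / (w k + Complex.I))))
    convert hg using 1
    · rfl
    · ext m
      rw [mul_pow, map_mul, map_pow]
      ring
    · have h4 : 1 - (w i - Complex.I) / (w i + Complex.I)
          * conj ((w k - Complex.I) / (w k + Complex.I))
          = -2 * Complex.I * (w i - conj (w k))
            / ((w i + Complex.I) * (conj (w k) - Complex.I)) := by
        simp only [map_div₀, map_sub, map_add, Complex.conj_I]
        rw [← sub_eq_add_neg]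
        field_simp
        ring
      rw [h4]
      simp only [map_div₀, map_add, Complex.conj_I]
      rw [← sub_eq_add_neg]
      field_simp
      simp
  have hs := hasSum_sum (fun i hi => hasSum_sum (fun k hk => key i hi k hk))
  have hs' := Complex.hasSum_re hs
  convert hs' using 1
  ext m
  have : ∀ z : ℂ, ‖z‖ ^ 2 = (z * conj z).re := fun z => by
    rw [Complex.mul_conj, Complex.normSq_eq_norm_sq]; norm_cast
  rw [this, map_sum, Finset.sum_mul_sum]
  simp_rw [← Finset.mul_sum]
  simp

theorem cauchyKernel_nonneg (T : Finset ι) (w c : ι → ℂ) (hT : ∀ i ∈ T, 0 < (w i).im) :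
    0 ≤ (∑ i ∈ T, ∑ k ∈ T, c i * conj (c k) * (Complex.I / (w i - conj (w k)))).re :=
  (hasSum_cauchyKernel T w c hT).nonneg fun _ => by positivity

/-- A vanishing sum of squares kills every moment of the weights c_i/(w_i + i) at the Cayley images
of the nodes; these are distinct, so the Vandermonde system has only the zero solution. -/
theorem eq_zero_of_cauchyKernel_eq_zero (T : Finset ι) (w c : ι → ℂ)
    (hT : ∀ i ∈ T, 0 < (w i).im) (hw : Set.InjOn w T)
    (h : (∑ i ∈ T, ∑ k ∈ T, c i * conj (c k) * (Complex.I / (w i - conj (w k)))).re = 0) :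
    ∀ i ∈ T, c i = 0 := by
  have hne : ∀ i ∈ T, w i + Complex.I ≠ 0 := fun i hi h => by
    have := congrArg Complex.im h
    have := hT i hi
    simp at *
    linarith
  have hs := hasSum_cauchyKernel T w c hT
  rw [h] at hs
  have hz := (hasSum_zero_iff_of_nonneg (fun _ => by positivity)).1 hs
  have hm : ∀ m : ℕ, ∑ i ∈ T, c i / (w i + Complex.I)
        * ((w i - Complex.I) / (w i + Complex.I)) ^ m = 0 := fun m => by
    have := congrFun hz m
    simpa using this
  let e := T.equivFin.symm
  have hv := Matrix.eq_zero_of_forall_pow_sum_mul_pow_eq_zero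
    (f := fun l => (w (e l) - Complex.I) / (w (e l) + Complex.I))
    (v := fun l => c (e l) / (w (e l) + Complex.I)) ?_ ?_
  · intro i hi
    have := congrFun hv (e.symm ⟨i, hi⟩)
    simp only [Equiv.apply_symm_apply, Pi.zero_apply] at this
    exact (div_eq_zero_iff.1 this).resolve_right (hne i hi)
  · intro l l' hl
    have h1 := hne _ (e l).2
    have h2 := hne _ (e l').2
    simp only at hl
    rw [div_eq_div_iff h1 h2] at hl
    have : 2 * Complex.I * (w (e l) - w (e l')) = 0 := by linear_combination hl
    have h3 : w (e l) = w (e l') := by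
      simpa [sub_eq_zero] using this
    exact e.injective (Subtype.ext (hw (e l).2 (e l').2 h3))
  · intro m
    rw [← hm m, ← Finset.sum_coe_sort T]
    exact Fintype.sum_equiv e _ _ fun l => rfl

end CauchyKernel

/-- A Calogero–Moser matrix with non-real, conjugation-invariant nodes and anti-invariant diagonal
is non-degenerate. -/
theorem det_cmMatrix_ne_zero {ι : Type*} [Fintype ι] [DecidableEq ι] {w g : ι → ℂ} {σ : ι → ι}
    (hσ : Function.Involutive σ) (hw : Function.Injective w) (hc : ∀ i, conj (w i) = w (σ i))
    (him : ∀ i, (w i).im ≠ 0) (hg : ∀ i, conj (g i) = -g (σ i)) :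
    (cmMatrix w g).det ≠ 0 := by
  intro hdet
  obtain ⟨c, hc0, hcG⟩ := Matrix.exists_mulVec_eq_zero_iff.2 hdet
  set G := cmMatrix w g with hG
  -- G is skew-Hermitian up to the involution σ, so the kernel vector c yields the left kernel
  -- vector d.
  have hGσ : ∀ i k, conj (G (σ i) (σ k)) = -G k i := by
    intro i k
    by_cases h : i = k
    · subst h
      simp [hG, cmMatrix, hg, hσ i]
    · have h' : ¬ k = i := fun e => h e.symm
      have h'' : ¬ σ i = σ k := fun e => h (hσ.injective e)
      simp only [hG, cmMatrix, of_apply, h', h'', if_false]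
      rw [map_div₀, map_sub, hc, hc, hσ, hσ, map_one, ← neg_sub (w i), div_neg, neg_neg]
  have hrow : ∀ i, ∑ k, G i k * c k = 0 := fun i => congrFun hcG i
  set d : ι → ℂ := fun i => conj (c (σ i)) with hd
  have hcol : ∀ i, ∑ k, d k * G k i = 0 := by
    intro i
    have h := congrArg conj (hrow (σ i))
    rw [map_sum, map_zero] at h
    rw [← neg_eq_zero, ← h, ← Finset.sum_neg_distrib]
    refine Fintype.sum_equiv (hσ.toPerm) _ _ fun k => ?_
    have := hGσ i k
    rw [map_mul]
    change _ = conj (G (σ i) (σ k)) * conj (c (σ k))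
    rw [this]
    ring
  set T : Finset ι := Finset.univ.filter fun i => 0 < (w i).im with hTdef
  have hT : ∀ i ∈ T, 0 < (w i).im := fun i hi => (Finset.mem_filter.1 hi).2
  have hσT : ∀ i, i ∉ T ↔ σ i ∈ T := by
    intro i
    have h1 : (w (σ i)).im = -(w i).im := by rw [← hc]; simp
    simp only [hTdef, Finset.mem_filter, Finset.mem_univ, true_and, h1, not_lt]
    have := him i
    constructor
    · intro h; have := lt_of_le_of_ne h this; linarith
    · intro h; linarith
  have hsum : ∑ i ∈ T, ∑ k, (d i * G i k * c k - d k * G k i * c i) = 0 := by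
    refine Finset.sum_eq_zero fun i _ => ?_
    rw [Finset.sum_sub_distrib]
    simp_rw [mul_assoc (d i), ← Finset.mul_sum, ← Finset.sum_mul, hrow, hcol]
    simp
  -- Within the upper half-plane block the two terms cancel after exchanging i and k, so the unknown
  -- diagonal `g` drops out.
  have hsplit : ∑ i ∈ T, ∑ k ∈ T, (d i * G i k * c k - d k * G k i * c i) = 0 := by
    simp_rw [Finset.sum_sub_distrib]
    rw [sub_eq_zero, Finset.sum_comm]
  -- Only pairs of an upper and a lower node remain. Reindexed by σ, their entries 1/(w_i - w_k)
  -- become the Cauchy kernel.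
  have hoff : ∑ i ∈ T, ∑ k ∈ T, (d i * conj (d k) + c i * conj (c k))
      * (1 / (w i - conj (w k))) = 0 := by
    have h := hsum
    simp_rw [← Finset.sum_add_sum_compl T, Finset.sum_add_distrib, hsplit, zero_add] at h
    rw [← h]
    refine Finset.sum_congr rfl fun i hi => ?_
    refine Finset.sum_nbij' σ σ ?_ ?_ (fun k _ => hσ k) (fun k _ => hσ k) fun k hk => ?_
    · intro k hk
      rw [Finset.mem_compl, hσT, hσ]
      exact hk
    · intro k hk
      rw [Finset.mem_compl, hσT] at hk
      exact hk
    · have h1 : i ≠ σ k := fun e => (hσT k).2 (e ▸ hi) hk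
      simp only [hG, cmMatrix, of_apply, h1, h1.symm, if_false, hd, hσ k, ← hc k,
        Complex.conj_conj]
      rw [← neg_sub (w i) (conj (w k)), div_neg]
      ring
  have hquad : ∑ i ∈ T, ∑ k ∈ T, d i * conj (d k) * (Complex.I / (w i - conj (w k)))
      + ∑ i ∈ T, ∑ k ∈ T, c i * conj (c k) * (Complex.I / (w i - conj (w k))) = 0 := by
    rw [← mul_zero Complex.I, ← hoff, Finset.mul_sum, ← Finset.sum_add_distrib]
    refine Finset.sum_congr rfl fun i _ => ?_
    rw [Finset.mul_sum, ← Finset.sum_add_distrib]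
    refine Finset.sum_congr rfl fun k _ => ?_
    ring
  have hre := congrArg Complex.re hquad
  rw [Complex.add_re, Complex.zero_re] at hre
  have p1 := cauchyKernel_nonneg T w d hT
  have p2 := cauchyKernel_nonneg T w c hT
  have z1 := eq_zero_of_cauchyKernel_eq_zero T w d hT hw.injOn (by linarith)
  have z2 := eq_zero_of_cauchyKernel_eq_zero T w c hT hw.injOn (by linarith)
  refine hc0 (funext fun i => ?_)
  by_cases hi : i ∈ T
  · exact z2 i hi
  · have := z1 _ ((hσT i).1 hi)
    simpa [hd, hσ i] using this

theorem HasDerivAt.congr_fun_deriv {𝕜 F : Type*} [NontriviallyNormedField 𝕜]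
    [NormedAddCommGroup F] [NormedSpace 𝕜 F] {f g : 𝕜 → F} {f' g' : F} {x : 𝕜}
    (h : HasDerivAt f f' x) (hfg : ∀ y, g y = f y) (he : g' = f') : HasDerivAt g g' x := by
  rw [he, funext hfg]
  exact h

/-! ### Partial fractions of 1/f and its critical points -/

section RationalMap

variable {m : ℕ} {a : Fin m → ℝ} {b : Fin m → ℂ}

/-- The residues of `1 / f` at the zeros of `f`. -/
def invResidue (a : Fin m → ℝ) (b : Fin m → ℂ) (i : Fin m) : ℂ :=
  Lagrange.nodalWeight Finset.univ (fun k => (a k : ℂ)) i * ∏ k, ((a i : ℂ) - b k)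

theorem invResidue_eq_div (a : Fin m → ℝ) (b : Fin m → ℂ) (i : Fin m) :
    invResidue a b i
      = (∏ k, ((a i : ℂ) - b k)) / ∏ k ∈ Finset.univ.erase i, ((a i : ℂ) - a k) := by
  rw [invResidue, Lagrange.nodalWeight, Finset.prod_inv_distrib, div_eq_inv_mul]

theorem ofReal_comp_injOn (ha : Function.Injective a) (s : Set (Fin m)) :
    Set.InjOn (fun k => (a k : ℂ)) s :=
  fun _ _ _ _ h => ha (Complex.ofReal_injective h)

theorem invResidue_ne_zero (ha : Function.Injective a) (hab : ∀ i k, (a i : ℂ) ≠ b k)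
    (i : Fin m) : invResidue a b i ≠ 0 :=
  mul_ne_zero (Lagrange.nodalWeight_ne_zero (ofReal_comp_injOn ha _) (Finset.mem_univ i))
    (Finset.prod_ne_zero_iff.2 fun k _ => sub_ne_zero.2 (hab i k))

theorem conj_invResidue (hb : ∃ σ : Equiv.Perm (Fin m), ∀ i, conj (b i) = b (σ i)) (i : Fin m) :
    conj (invResidue a b i) = invResidue a b i := by
  obtain ⟨σ, hσ⟩ := hb
  rw [invResidue_eq_div, map_div₀, map_prod, map_prod]
  simp only [map_sub, Complex.conj_ofReal, hσ]
  rw [Equiv.prod_comp σ fun k => (a i : ℂ) - b k]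

theorem rationalMap_inv (a : Fin m → ℝ) (b : Fin m → ℂ) (w : ℂ) :
    (rationalMap a b w)⁻¹ = ∏ i, (w - b i) / (w - (a i : ℂ)) := by
  rw [rationalMap, ← Finset.prod_inv_distrib]
  simp_rw [inv_div]

/-- The partial fraction decomposition of `1 / f`. -/
theorem rationalMap_inv_eq (ha : Function.Injective a) {w : ℂ} (hw : ∀ i, w ≠ (a i : ℂ)) :
    (rationalMap a b w)⁻¹ = 1 + ∑ i, invResidue a b i * (1 / (w - (a i : ℂ))) := by
  classical
  have hv := ofReal_comp_injOn ha (Finset.univ : Finset (Fin m))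
  set v : Fin m → ℂ := fun k => (a k : ℂ) with hvdef
  -- Numerator and denominator of 1/f are both monic of degree m. Their difference has smaller
  -- degree, hence equals its Lagrange interpolant at the zeros of f; the constant 1 is the value of
  -- 1/f at infinity.
  have hdeg : (Lagrange.nodal Finset.univ b - Lagrange.nodal Finset.univ v).degree
      < (Finset.univ : Finset (Fin m)).card := by
    have h := Polynomial.degree_sub_lt_left (p := Lagrange.nodal Finset.univ b)
      (q := Lagrange.nodal Finset.univ v) (by rw [Lagrange.degree_nodal, Lagrange.degree_nodal])
      Lagrange.nodal_ne_zero
      (by rw [Lagrange.nodal_monic.leadingCoeff, Lagrange.nodal_monic.leadingCoeff])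
    rwa [Lagrange.degree_nodal] at h
  have hint := Lagrange.eq_interpolate hv hdeg
  have h := congrArg (Polynomial.eval w) hint
  rw [Lagrange.eval_interpolate_not_at_node _ (fun i _ => hw i), Polynomial.eval_sub] at h
  have h0 : Polynomial.eval w (Lagrange.nodal Finset.univ v) ≠ 0 :=
    Lagrange.eval_nodal_not_at_node fun i _ => hw i
  rw [rationalMap_inv, Finset.prod_div_distrib, ← Lagrange.eval_nodal (v := b),
    ← Lagrange.eval_nodal (v := v), div_eq_iff h0, add_mul, one_mul, ← sub_eq_iff_eq_add', h,
    mul_comm]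
  congr 1
  refine Finset.sum_congr rfl fun i _ => ?_
  rw [Polynomial.eval_sub, Lagrange.eval_nodal_at_node (Finset.mem_univ i), sub_zero,
    Lagrange.eval_nodal, invResidue, one_div]
  ring

theorem hasDerivAt_rationalMap_zero (hab : ∀ i k, (a i : ℂ) ≠ b k) (i : Fin m) :
    HasDerivAt (rationalMap a b) (invResidue a b i)⁻¹ (a i) := by
  have hprod : ∏ k, ((a i : ℂ) - b k) ≠ 0 :=
    Finset.prod_ne_zero_iff.2 fun k _ => sub_ne_zero.2 (hab i k)
  have hh : DifferentiableAt ℂ (fun w : ℂ => (∏ k ∈ Finset.univ.erase i, (w - (a k : ℂ)))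
      * (∏ k, (w - b k))⁻¹) (a i) := by
    refine DifferentiableAt.mul (by fun_prop) (DifferentiableAt.inv (by fun_prop) hprod)
  have h := ((hasDerivAt_id (a i : ℂ)).sub_const (a i : ℂ)).mul hh.hasDerivAt
  refine h.congr_fun_deriv (fun w => ?_) ?_
  · rw [rationalMap, Finset.prod_div_distrib, ← Finset.mul_prod_erase _ _ (Finset.mem_univ i)]
    simp only [Pi.mul_apply, id, div_eq_mul_inv, mul_assoc]
  · rw [invResidue_eq_div]
    simp [div_eq_mul_inv, mul_comm]

theorem deriv_rationalMap_zero (hab : ∀ i k, (a i : ℂ) ≠ b k) (i : Fin m) :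
    1 / deriv (rationalMap a b) (a i) = invResidue a b i := by
  rw [(hasDerivAt_rationalMap_zero hab i).deriv, one_div, inv_inv]

theorem hasDerivAt_rationalMap_inv (ha : Function.Injective a) {w : ℂ}
    (hw : ∀ i, w ≠ (a i : ℂ)) :
    HasDerivAt (fun z => (rationalMap a b z)⁻¹)
      (-∑ i, invResidue a b i * (1 / (w - (a i : ℂ)) ^ 2)) w := by
  have h : HasDerivAt (fun z => 1 + ∑ i, invResidue a b i * (1 / (z - (a i : ℂ))))
      (-∑ i, invResidue a b i * (1 / (w - (a i : ℂ)) ^ 2)) w := by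
    rw [← Finset.sum_neg_distrib]
    refine HasDerivAt.const_add 1 (HasDerivAt.fun_sum fun i _ => ?_)
    have := ((hasDerivAt_id w).sub_const (a i : ℂ)).inv (sub_ne_zero.2 (hw i))
    refine (this.const_mul (invResidue a b i)).congr_fun_deriv (fun z => ?_) ?_
    · simp
    · simp only [id]; ring
  refine h.congr_of_eventuallyEq ?_
  have : ∀ᶠ z in nhds w, ∀ i, z ≠ (a i : ℂ) :=
    Filter.eventually_all.2 fun i => isOpen_ne.mem_nhds (hw i)
  filter_upwards [this] with z hz
  exact rationalMap_inv_eq ha hz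

/-- Away from the poles f is the inverse of the non-vanishing function 1/f, so both alternatives of
the definition amount to (1/f)' = 0, which partial fractions compute. At a pole the default value of
`rationalMap` agrees with this formula for 1/f. -/
theorem isCriticalPoint_iff (ha : Function.Injective a) {w : ℂ} (hw : ∀ i, w ≠ (a i : ℂ)) :
    IsCriticalPoint a b w ↔ ∑ i, invResidue a b i * (1 / (w - (a i : ℂ)) ^ 2) = 0 := by
  have hd := hasDerivAt_rationalMap_inv (b := b) ha hw
  rw [IsCriticalPoint, hd.deriv, neg_eq_zero]
  by_cases hb : ∃ i, w = b i
  · have : ¬ ∀ i, w ≠ b i := by push Not; exact hb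
    simp [hb, this]
  · have hb' : ∀ i, w ≠ b i := by push Not at hb; exact hb
    have h0 : (rationalMap a b w)⁻¹ ≠ 0 := by
      rw [rationalMap_inv]
      exact Finset.prod_ne_zero_iff.2 fun i _ =>
        div_ne_zero (sub_ne_zero.2 (hb' i)) (sub_ne_zero.2 (hw i))
    have hf := (hd.inv h0).congr_fun_deriv (g := rationalMap a b) (fun z => by simp) rfl
    rw [hf.deriv]
    simp only [hb', ne_eq, not_false_eq_true, implies_true, true_and,
      neg_neg, div_eq_zero_iff]
    have h1 : rationalMap a b w ≠ 0 := by simpa using h0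
    simp [h1]

end RationalMap

/-! ### Real residues and the conjugation-invariant nodes -/

namespace BreatherData

variable {n N : ℕ} (D : BreatherData n N)

/-- The real residues of `1 / f`. -/
def c (i : Fin (n + 1)) : ℝ := (invResidue D.a D.b i).re

theorem ofReal_c (i : Fin (n + 1)) : (D.c i : ℂ) = invResidue D.a D.b i :=
  (Complex.conj_eq_iff_re.1 (conj_invResidue D.poles_conj i))

theorem one_div_df (i : Fin (n + 1)) : 1 / D.df i = D.c i := by
  rw [ofReal_c]
  exact deriv_rationalMap_zero D.a_ne_b i

theorem one_div_df_sq (i : Fin (n + 1)) : 1 / D.df i ^ 2 = (D.c i : ℂ) ^ 2 := by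
  rw [← one_div_df, div_pow, one_pow]

theorem df_eq (i : Fin (n + 1)) : D.df i = ((D.c i)⁻¹ : ℝ) := by
  rw [Complex.ofReal_inv, ← one_div_df, one_div, inv_inv]

theorem c_ne_zero (i : Fin (n + 1)) : D.c i ≠ 0 := by
  rw [← Complex.ofReal_ne_zero, ofReal_c]
  exact invResidue_ne_zero D.a_injective D.a_ne_b i

theorem isCriticalPoint_iff_sum {w : ℂ} (hw : ∀ i, w ≠ (D.a i : ℂ)) :
    IsCriticalPoint D.a D.b w ↔ ∑ i, 1 / D.df i * (1 / (w - (D.a i : ℂ)) ^ 2) = 0 := by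
  rw [isCriticalPoint_iff D.a_injective hw]
  simp_rw [one_div_df, ofReal_c]

/-- A real critical point would coincide with its own conjugate. -/
theorem u_im_ne_zero (k : Fin N) : (D.u k).im ≠ 0 := by
  intro h
  have : conj (D.u k) = D.u k := Complex.conj_eq_iff_im.2 h
  have := @D.uv_injective (Sum.inl k) (Sum.inr k) (by simp [this])
  exact Sum.inl_ne_inr this

/-- The `2N` critical points. -/
def w : Fin N ⊕ Fin N → ℂ := Sum.elim D.u fun k => conj (D.u k)

theorem w_im_ne_zero (i : Fin N ⊕ Fin N) : (D.w i).im ≠ 0 := by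
  rcases i with k | k <;> simp [w, D.u_im_ne_zero k]

theorem w_injective : Function.Injective D.w := D.uv_injective

theorem conj_w (i : Fin N ⊕ Fin N) : conj (D.w i) = D.w i.swap := by
  rcases i with k | k <;> simp [w]

theorem w_ne_ofReal (x : ℝ) (i : Fin N ⊕ Fin N) : D.w i ≠ x := by
  intro h
  exact D.w_im_ne_zero i (by rw [h, Complex.ofReal_im])

theorem w_critical (i : Fin N ⊕ Fin N) :
    ∑ m, (D.c m : ℂ) * (1 / (D.w i - (D.a m : ℂ)) ^ 2) = 0 := by
  have hu : ∀ k, ∑ m, (D.c m : ℂ) * (1 / (D.u k - (D.a m : ℂ)) ^ 2) = 0 := by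
    intro k
    have := (D.isCriticalPoint_iff_sum (w := D.u k)
      (fun m => D.w_ne_ofReal (D.a m) (Sum.inl k))).1 (D.u_critical k)
    simpa only [one_div_df] using this
  rcases i with k | k
  · exact hu k
  · have := congrArg conj (hu k)
    simpa [w] using this

end BreatherData

/-! ### Derivatives of the inverse of an affine matrix family -/

section MatrixCalculus

open scoped Matrix.Norms.Operator

variable {ι : Type*} [Fintype ι] [DecidableEq ι]

theorem hasDerivAt_matrix_inv {G : ℝ → Matrix ι ι ℂ} {G' : Matrix ι ι ℂ} {x : ℝ}
    (h : HasDerivAt G G' x) (hG : (G x).det ≠ 0) :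
    HasDerivAt (fun y => (G y)⁻¹) (-((G x)⁻¹ * G' * (G x)⁻¹)) x := by
  obtain ⟨U, hU⟩ := (Matrix.isUnit_iff_isUnit_det (G x)).2 hG.isUnit
  have h1 := hasFDerivAt_ringInverse (𝕜 := ℝ) U
  rw [hU] at h1
  have h2 := h1.comp_hasDerivAt x h
  refine h2.congr_fun_deriv (fun y => ?_) ?_
  · simp [Matrix.nonsing_inv_eq_ringInverse]
  · rw [Matrix.nonsing_inv_eq_ringInverse, ← hU, Ring.inverse_unit]
    simp

omit [DecidableEq ι] in
theorem HasDerivAt.dotProduct_mulVec_const {M : ℝ → Matrix ι ι ℂ} {M' : Matrix ι ι ℂ} {x : ℝ}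
    (h : HasDerivAt M M' x) (u v : ι → ℂ) :
    HasDerivAt (fun y => u ⬝ᵥ M y *ᵥ v) (u ⬝ᵥ M' *ᵥ v) x := by
  let L : Matrix ι ι ℂ →ₗ[ℝ] ℂ :=
    { toFun := fun A => u ⬝ᵥ A *ᵥ v
      map_add' := fun A B => by rw [add_mulVec, dotProduct_add]
      map_smul' := fun r A => by rw [smul_mulVec, dotProduct_smul]; rfl }
  exact (LinearMap.toContinuousLinearMap L).hasFDerivAt.comp_hasDerivAt x h

variable {G : ℝ → Matrix ι ι ℂ} {G₀ G' : Matrix ι ι ℂ} (hG : ∀ y, G y = G₀ + y • G')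
  (hdet : ∀ y, (G y).det ≠ 0)
include hG hdet

theorem hasDerivAt_inv_of_affine (u v : ι → ℂ) (x : ℝ) :
    HasDerivAt (fun y => u ⬝ᵥ (G y)⁻¹ *ᵥ v) (-(u ⬝ᵥ ((G x)⁻¹ * G' * (G x)⁻¹) *ᵥ v)) x := by
  have h : HasDerivAt G G' x :=
    (((hasDerivAt_id x).smul_const G').const_add G₀).congr_fun_deriv hG (by simp)
  refine ((hasDerivAt_matrix_inv h (hdet x)).dotProduct_mulVec_const u v).congr_fun_deriv
    (fun _ => rfl) ?_
  rw [neg_mulVec, dotProduct_neg]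

theorem hasDerivAt_inv_mul_inv_of_affine (u v : ι → ℂ) (x : ℝ) :
    HasDerivAt (fun y => u ⬝ᵥ ((G y)⁻¹ * G' * (G y)⁻¹) *ᵥ v)
      (-(2 * (u ⬝ᵥ ((G x)⁻¹ * G' * (G x)⁻¹ * G' * (G x)⁻¹) *ᵥ v))) x := by
  have h : HasDerivAt G G' x :=
    (((hasDerivAt_id x).smul_const G').const_add G₀).congr_fun_deriv hG (by simp)
  have h1 := hasDerivAt_matrix_inv h (hdet x)
  refine (((h1.mul_const G').mul h1).dotProduct_mulVec_const u v).congr_fun_deriv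
    (fun _ => rfl) ?_
  rw [two_mul, ← dotProduct_add, ← add_mulVec, ← dotProduct_neg, ← neg_mulVec]
  congr 2
  noncomm_ring

end MatrixCalculus

/-! ### The wave functions φ_j and their moduli -/

namespace BreatherData

variable {n N : ℕ} (D : BreatherData n N)

/-- The residue at the distinguished zero. -/
abbrev cLast : ℝ := D.c (Fin.last n)

/-- The vector with entries `1 / (w_k - w_{a_{n+1}})`. -/
abbrev p : Fin N ⊕ Fin N → ℂ := poleVec D.w D.aLast

/-- The vector with entries `1 / (w_k - w_{a_j})`. -/
abbrev ℓ (j : Fin n) : Fin N ⊕ Fin N → ℂ := poleVec D.w (D.aj j)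

/-- The constant terms of the diagonal entries. -/
def δ : Fin N ⊕ Fin N → ℂ := Sum.elim D.d fun k => -conj (D.d k)

/-- The diagonal of the Calogero–Moser matrix at the point `(x, t)`. -/
def ζ (x t : ℝ) (i : Fin N ⊕ Fin N) : ℂ :=
  Complex.I * D.cLast * D.p i ^ 2 * x + 2 * Complex.I * D.cLast ^ 2 * D.p i ^ 3 * t - D.δ i

/-- The Calogero–Moser matrix at the point `(x, t)`. -/
def G (x t : ℝ) : Matrix (Fin N ⊕ Fin N) (Fin N ⊕ Fin N) ℂ := cmMatrix D.w (D.ζ x t)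

theorem w_ne_aLast (i : Fin N ⊕ Fin N) : D.w i ≠ D.aLast := D.w_ne_ofReal _ i

theorem w_ne_aj (j : Fin n) (i : Fin N ⊕ Fin N) : D.w i ≠ D.aj j := D.w_ne_ofReal _ i

theorem aLast_ne_aj (j : Fin n) : D.aLast ≠ D.aj j := fun h =>
  (Fin.castSucc_lt_last j).ne' (D.a_injective (Complex.ofReal_injective h))

theorem conj_poleVec (x : ℝ) (i : Fin N ⊕ Fin N) :
    conj (poleVec D.w x i) = poleVec D.w x i.swap := by
  simp [poleVec, conj_w]

theorem conj_ζ (x t : ℝ) (i : Fin N ⊕ Fin N) : conj (D.ζ x t i) = -D.ζ x t i.swap := by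
  have h : conj (D.δ i) = -D.δ i.swap := by rcases i with k | k <;> simp [δ]
  have hp : conj (D.p i) = D.p i.swap := D.conj_poleVec _ i
  simp only [ζ, map_sub, map_add, map_mul, map_pow, Complex.conj_I, Complex.conj_ofReal, h, hp,
    map_ofNat]
  ring

theorem det_G_ne_zero (x t : ℝ) : (D.G x t).det ≠ 0 :=
  det_cmMatrix_ne_zero Sum.swap_swap D.w_injective D.conj_w D.w_im_ne_zero (D.conj_ζ x t)

/-- The minus signs in the even-indexed V̂, Ŵ and r̂ are what lets one formula in the node w_i
describe both halves of the diagonal once the odd rows change sign. -/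
theorem K_eq (j : Fin n) (β : ℂ) (x t : ℝ) :
    D.K j β x t = diagonal (Sum.elim (fun _ => -1) fun _ => 1)
      * cmMatrix D.w (D.ζ x t + β • (D.ℓ j - D.p)) := by
  have hu1 : ∀ k, D.u k - D.aLast ≠ 0 := fun k => sub_ne_zero.2 (D.w_ne_aLast (Sum.inl k))
  have hu1' : ∀ k, D.u k - D.aj j ≠ 0 := fun k => sub_ne_zero.2 (D.w_ne_aj j (Sum.inl k))
  have hv1 : ∀ k, conj (D.u k) - D.aLast ≠ 0 :=
    fun k => sub_ne_zero.2 (D.w_ne_aLast (Sum.inr k))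
  have hv1' : ∀ k, conj (D.u k) - D.aj j ≠ 0 := fun k => sub_ne_zero.2 (D.w_ne_aj j (Sum.inr k))
  have cL : conj D.aLast = D.aLast := Complex.conj_ofReal _
  have cj : conj (D.aj j) = D.aj j := Complex.conj_ofReal _
  ext i k
  rw [diagonal_mul]
  rcases i with i | i <;> rcases k with k | k
  · by_cases h : i = k
    · subst h
      simp only [K, cmMatrix, of_apply, fromBlocks_apply₁₁, if_true, Sum.elim_inl, z, V, W, r,
        dHat, ζ, δ, p, ℓ, poleVec, w, Pi.add_apply, Pi.smul_apply, Pi.sub_apply, smul_eq_mul,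
        one_div_df_sq, one_div_df]
      rw [← neg_sub (D.u i) D.aLast, ← neg_sub (D.u i) (D.aj j)]
      have h1 := hu1 i
      have h2 := hu1' i
      field_simp
      ring
    · simp [K, cmMatrix, h, w]
  · simp [K, cmMatrix, w, v]
  · simp [K, cmMatrix, w, v]
  · by_cases h : i = k
    · subst h
      simp only [K, cmMatrix, of_apply, fromBlocks_apply₂₂, if_true, Sum.elim_inr, z, V, W, r,
        dHat, ζ, δ, p, ℓ, poleVec, w, Pi.add_apply, Pi.smul_apply, Pi.sub_apply, smul_eq_mul,
        one_div_df_sq, one_div_df, map_neg, map_mul, map_div₀, map_pow, map_sub, map_one, cL, cj,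
        Complex.conj_ofReal, map_ofNat]
      rw [← neg_sub (conj (D.u i)) D.aLast, ← neg_sub (conj (D.u i)) (D.aj j)]
      have h1 := hv1 i
      have h2 := hv1' i
      field_simp
      ring
    · simp [K, cmMatrix, h, w, v]

theorem det_sign_ne_zero :
    (diagonal (Sum.elim (fun _ => -1) fun _ => 1) :
      Matrix (Fin N ⊕ Fin N) (Fin N ⊕ Fin N) ℂ).det ≠ 0 := by
  simp [det_diagonal]

theorem det_K_zero_ne_zero (j : Fin n) (x t : ℝ) : (D.K j 0 x t).det ≠ 0 := by
  rw [K_eq, det_mul, zero_smul, add_zero]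
  exact mul_ne_zero det_sign_ne_zero (D.det_G_ne_zero x t)

/-- The wave function `det 𝕂_{j,1} / det 𝕂_{j,0}`. -/
def φ (j : Fin n) (x t : ℝ) : ℂ := (D.K j 1 x t).det / (D.K j 0 x t).det

theorem φ_eq_div (j : Fin n) (x t : ℝ) :
    D.φ j x t = (cmMatrix D.w (D.ζ x t + (D.ℓ j - D.p))).det / (D.G x t).det := by
  rw [φ, K_eq, K_eq, det_mul, det_mul, zero_smul, add_zero, one_smul,
    mul_div_mul_left _ _ det_sign_ne_zero]
  rfl

theorem φ_eq (j : Fin n) (x t : ℝ) :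
    D.φ j x t = 1 + (D.aj j - D.aLast) * (D.ℓ j ⬝ᵥ (D.G x t)⁻¹ *ᵥ D.p) := by
  rw [φ_eq_div, G, det_cmMatrix_add_poleVec D.w_injective _ D.w_ne_aLast (D.w_ne_aj j)
    (D.det_G_ne_zero x t)]
  exact mul_div_cancel_left₀ _ (D.det_G_ne_zero x t)

/-- Conjugation permutes the nodes; undoing the permutation and transposing leaves only a factor -1
on the matrix, invisible in the determinant since the size 2N is even. -/
theorem conj_det_cmMatrix (g : Fin N ⊕ Fin N → ℂ) :
    conj (cmMatrix D.w g).det = (cmMatrix D.w fun i => -conj (g i.swap)).det := by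
  have h : (cmMatrix D.w fun i => -conj (g i.swap))ᵀ
      = -(((starRingEnd ℂ).mapMatrix (cmMatrix D.w g)).submatrix Sum.swap Sum.swap) := by
    rw [cmMatrix_transpose]
    congr 1
    ext i k
    by_cases e : i = k
    · subst e; simp [cmMatrix]
    · have e' : ¬ i.swap = k.swap := fun q => e (by simpa using congrArg Sum.swap q)
      simp [cmMatrix, e, e', conj_w]
  rw [← det_transpose (cmMatrix D.w fun i => -conj (g i.swap)), h, det_neg, RingHom.map_det]
  have : ((starRingEnd ℂ).mapMatrix (cmMatrix D.w g)).submatrix Sum.swap Sum.swap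
      = ((starRingEnd ℂ).mapMatrix (cmMatrix D.w g)).submatrix (Equiv.sumComm _ _)
        (Equiv.sumComm _ _) := rfl
  rw [this, det_submatrix_equiv_self]
  simp [← two_mul]

/-- Conjugation leaves G's determinant fixed and reverses the shift ℓ_j - p. The determinant formula
thus applies with the two poles exchanged and gives the adjoint wave function. -/
theorem conj_φ (j : Fin n) (x t : ℝ) :
    conj (D.φ j x t) = 1 - (D.aj j - D.aLast) * (D.p ⬝ᵥ (D.G x t)⁻¹ *ᵥ D.ℓ j) := by
  have h1 : (fun i => -conj ((D.ζ x t + (D.ℓ j - D.p)) i.swap))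
      = D.ζ x t + (D.p - D.ℓ j) := by
    ext i
    simp only [Pi.add_apply, Pi.sub_apply, map_add, map_sub, conj_ζ, Sum.swap_swap, p, ℓ, aLast,
      aj, conj_poleVec]
    ring
  have h2 : (fun i => -conj (D.ζ x t i.swap)) = D.ζ x t := by
    ext i
    simp [conj_ζ]
  have h3 := det_cmMatrix_add_poleVec D.w_injective (D.ζ x t) (D.w_ne_aj j) D.w_ne_aLast
    (D.det_G_ne_zero x t)
  rw [φ_eq_div, map_div₀, conj_det_cmMatrix, h1, G, conj_det_cmMatrix, h2, h3]
  refine (mul_div_cancel_left₀ _ (D.det_G_ne_zero x t)).trans ?_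
  rw [← neg_sub (D.aj j), neg_mul, ← sub_eq_add_neg]

theorem norm_φ_sq (j : Fin n) (x t : ℝ) :
    (((‖D.φ j x t‖ ^ 2 : ℝ)) : ℂ) - 1 = -((D.aj j - D.aLast) ^ 2 *
      (D.ℓ j ⬝ᵥ ((D.G x t)⁻¹ * (diagonal D.p * diagonal D.p) * (D.G x t)⁻¹) *ᵥ D.ℓ j)) := by
  rw [← Complex.normSq_eq_norm_sq, ← Complex.mul_conj, conj_φ, φ_eq]
  exact wave_mul_adjoint_wave D.w_injective (D.det_G_ne_zero x t) (D.aLast_ne_aj j) D.w_ne_aLast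
    (D.w_ne_aj j)

theorem q₂_eq (j : Fin n) : D.q₂ j
    = ((D.cLast * D.c j.castSucc / (D.a (Fin.last n) - D.a j.castSucc) ^ 2 : ℝ) : ℂ) := by
  rw [q₂, df_eq, df_eq, aLast, aj]
  push_cast
  field_simp [D.c_ne_zero]

theorem E_eq (j : Fin n) : D.E j
    = ((D.cLast / (D.a j.castSucc - D.a (Fin.last n)) : ℝ) : ℂ) := by
  rw [E, df_eq, aLast, aj]
  push_cast
  field_simp [D.c_ne_zero]

theorem s_mul_A_sq (j : Fin n) : ((D.s j * D.A j ^ 2 : ℝ) : ℂ) = D.q₂ j := by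
  have h : D.a (Fin.last n) - D.a j.castSucc ≠ 0 := fun h =>
    D.aLast_ne_aj j (congrArg Complex.ofReal (sub_eq_zero.1 h))
  have h2 : 0 < (D.a (Fin.last n) - D.a j.castSucc) ^ 2 := by positivity
  have hl := D.c_ne_zero (Fin.last n)
  have hj := D.c_ne_zero j.castSucc
  rw [A, Real.sq_sqrt (norm_nonneg _), s, df_eq, df_eq, q₂_eq, ← Complex.ofReal_mul,
    Complex.ofReal_re, Complex.norm_real, Complex.ofReal_inj, Real.norm_eq_abs, abs_div,
    abs_of_pos h2, ← mul_inv]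
  rcases lt_or_gt_of_ne (mul_ne_zero hl hj) with h0 | h0
  · rw [Real.sign_of_neg (inv_lt_zero.2 h0), abs_of_neg h0]
    ring
  · rw [Real.sign_of_pos (inv_pos.2 h0), abs_of_pos h0, one_mul]

/-- The self-consistency relation. -/
theorem sum_q₂_mul_norm_sq_sub_one (x t : ℝ) :
    ∑ k, D.q₂ k * ((((‖D.φ k x t‖ ^ 2 : ℝ)) : ℂ) - 1) = D.cLast ^ 2 *
      (D.p ⬝ᵥ ((D.G x t)⁻¹ * (diagonal D.p * diagonal D.p) * (D.G x t)⁻¹) *ᵥ D.p) := by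
  -- The trace identity runs over all n + 1 zeros. Its last term is the potential; the others are
  -- the |φ_k|² - 1 by `norm_φ_sq`.
  have h := sum_poleVec_sq_eq_zero D.w_injective (D.det_G_ne_zero x t)
    (fun m => (D.c m : ℂ)) (fun m => (D.a m : ℂ)) (fun m i => D.w_ne_ofReal _ i) D.w_critical D.p
  rw [Fin.sum_univ_castSucc] at h
  set Y := (D.G x t)⁻¹ * (diagonal D.p * diagonal D.p) * (D.G x t)⁻¹
  replace h : ∑ k : Fin n, (D.c k.castSucc : ℂ) * (D.ℓ k ⬝ᵥ Y *ᵥ D.ℓ k)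
      + D.cLast * (D.p ⬝ᵥ Y *ᵥ D.p) = 0 := h
  have e : ∀ k : Fin n, D.q₂ k * ((((‖D.φ k x t‖ ^ 2 : ℝ)) : ℂ) - 1)
      = -D.cLast * ((D.c k.castSucc : ℂ) * (D.ℓ k ⬝ᵥ Y *ᵥ D.ℓ k)) := by
    intro k
    have h0 : D.aLast - D.aj k ≠ 0 := sub_ne_zero.2 (D.aLast_ne_aj k)
    rw [norm_φ_sq, q₂_eq]
    push_cast
    change (D.cLast : ℂ) * D.c k.castSucc / (D.aLast - D.aj k) ^ 2 * _ = _
    rw [← neg_sub D.aLast (D.aj k)]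
    field_simp
    rfl
  simp_rw [e, ← Finset.mul_sum]
  linear_combination (-(D.cLast : ℂ)) * h

end BreatherData

/-! ### The evolution equation and NLS -/

namespace BreatherData

variable {n N : ℕ} (D : BreatherData n N)

theorem G_eq_add (x t : ℝ) : D.G x t = cmMatrix D.w (-D.δ)
    + x • ((Complex.I * D.cLast) • (diagonal D.p * diagonal D.p))
    + t • ((2 * Complex.I * D.cLast ^ 2) • (diagonal D.p * diagonal D.p * diagonal D.p)) := by
  have h : D.ζ x t = -D.δ + fun i => Complex.I * D.cLast * D.p i ^ 2 * x
      + 2 * Complex.I * D.cLast ^ 2 * D.p i ^ 3 * t := by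
    ext i
    simp only [ζ, Pi.add_apply, Pi.neg_apply]
    ring
  rw [G, h, cmMatrix_add, add_assoc]
  congr 1
  simp only [diagonal_mul_diagonal, ← diagonal_smul, diagonal_add]
  congr 1
  ext i
  simp only [Pi.smul_apply, smul_eq_mul, Complex.real_smul]
  ring

/-- `∂φ/∂x`. -/
def φx (j : Fin n) (x t : ℝ) : ℂ :=
  -((D.aj j - D.aLast) * (Complex.I * D.cLast)
    * (D.ℓ j ⬝ᵥ ((D.G x t)⁻¹ * (diagonal D.p * diagonal D.p) * (D.G x t)⁻¹) *ᵥ D.p))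

/-- `∂²φ/∂x²`. -/
def φxx (j : Fin n) (x t : ℝ) : ℂ :=
  -(2 * (D.aj j - D.aLast) * D.cLast ^ 2
    * (D.ℓ j ⬝ᵥ ((D.G x t)⁻¹ * (diagonal D.p * diagonal D.p) * (D.G x t)⁻¹
      * (diagonal D.p * diagonal D.p) * (D.G x t)⁻¹) *ᵥ D.p))

/-- `∂φ/∂t`. -/
def φt (j : Fin n) (x t : ℝ) : ℂ :=
  -((D.aj j - D.aLast) * (2 * Complex.I * D.cLast ^ 2)
    * (D.ℓ j ⬝ᵥ ((D.G x t)⁻¹ * (diagonal D.p * diagonal D.p * diagonal D.p) * (D.G x t)⁻¹)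
      *ᵥ D.p))

theorem hasDerivAt_φ_x (j : Fin n) (x t : ℝ) :
    HasDerivAt (fun y => D.φ j y t) (D.φx j x t) x := by
  have h := hasDerivAt_inv_of_affine (G := fun y => D.G y t)
    (G₀ := cmMatrix D.w (-D.δ)
      + t • ((2 * Complex.I * D.cLast ^ 2) • (diagonal D.p * diagonal D.p * diagonal D.p)))
    (G' := (Complex.I * D.cLast) • (diagonal D.p * diagonal D.p))
    (fun y => by rw [G_eq_add, add_right_comm]) (fun y => D.det_G_ne_zero y t) (D.ℓ j) D.p x
  refine ((h.const_mul (D.aj j - D.aLast)).const_add 1).congr_fun_deriv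
    (fun y => D.φ_eq j y t) ?_
  simp only [φx, mul_smul, smul_mul_assoc, smul_mulVec, dotProduct_smul, smul_eq_mul, mul_smul_comm]
  ring

theorem hasDerivAt_φx (j : Fin n) (x t : ℝ) :
    HasDerivAt (fun y => D.φx j y t) (D.φxx j x t) x := by
  have h := hasDerivAt_inv_mul_inv_of_affine (G := fun y => D.G y t)
    (G₀ := cmMatrix D.w (-D.δ)
      + t • ((2 * Complex.I * D.cLast ^ 2) • (diagonal D.p * diagonal D.p * diagonal D.p)))
    (G' := (Complex.I * D.cLast) • (diagonal D.p * diagonal D.p))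
    (fun y => by rw [G_eq_add, add_right_comm]) (fun y => D.det_G_ne_zero y t) (D.ℓ j) D.p x
  refine (h.const_mul (-(D.aj j - D.aLast))).congr_fun_deriv (fun y => ?_) ?_
  · simp only [φx, smul_mul_assoc, smul_mulVec, dotProduct_smul, smul_eq_mul, mul_smul_comm]
    ring
  · simp only [φxx, smul_mul_assoc, smul_mulVec, dotProduct_smul, smul_eq_mul, mul_smul_comm]
    linear_combination (2 * (D.aj j - D.aLast) * D.cLast ^ 2
      * (D.ℓ j ⬝ᵥ ((D.G x t)⁻¹ * (diagonal D.p * diagonal D.p) * (D.G x t)⁻¹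
      * (diagonal D.p * diagonal D.p) * (D.G x t)⁻¹) *ᵥ D.p)) * -Complex.I_sq

theorem hasDerivAt_φ_t (j : Fin n) (x t : ℝ) :
    HasDerivAt (fun y => D.φ j x y) (D.φt j x t) t := by
  have h := hasDerivAt_inv_of_affine (G := fun y => D.G x y)
    (G₀ := cmMatrix D.w (-D.δ) + x • ((Complex.I * D.cLast) • (diagonal D.p * diagonal D.p)))
    (G' := (2 * Complex.I * D.cLast ^ 2) • (diagonal D.p * diagonal D.p * diagonal D.p))
    (fun y => D.G_eq_add x y) (fun y => D.det_G_ne_zero x y) (D.ℓ j) D.p t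
  refine ((h.const_mul (D.aj j - D.aLast)).const_add 1).congr_fun_deriv
    (fun y => D.φ_eq j x y) ?_
  simp only [φt, mul_smul, smul_mul_assoc, smul_mulVec, dotProduct_smul, smul_eq_mul, mul_smul_comm]
  ring

theorem E_mul (j : Fin n) : D.E j * (D.aj j - D.aLast) = D.cLast := by
  have h : D.aj j - D.aLast ≠ 0 := sub_ne_zero.2 (D.aLast_ne_aj j).symm
  rw [E, ← one_div_mul_one_div, one_div_df, mul_assoc, one_div_mul_cancel h, mul_one]

/-- The linear evolution equation of the wave functions. -/
theorem φ_evolution (j : Fin n) (x t : ℝ) :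
    Complex.I * D.φt j x t + D.φxx j x t - 2 * Complex.I * D.E j * D.φx j x t
      = -2 * (∑ k, D.q₂ k * ((((‖D.φ k x t‖ ^ 2 : ℝ)) : ℂ) - 1)) * D.φ j x t := by
  have h := wave_lax D.w_injective (D.det_G_ne_zero x t) (D.aLast_ne_aj j) D.w_ne_aLast
    (D.w_ne_aj j) rfl rfl
  rw [sum_q₂_mul_norm_sq_sub_one, φ_eq, φt, φxx, φx]
  change _ = _ * (1 + _ * (D.ℓ j ⬝ᵥ (cmMatrix D.w (D.ζ x t))⁻¹ *ᵥ D.p))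
  simp only [G]
  have hE := D.E_mul j
  -- This is 2c² times the Lax identity; E_j (a_j - a_{n+1}) = c matches the first-order term.
  linear_combination 2 * (D.cLast : ℂ) ^ 2 * h
    + (2 * Complex.I ^ 2 * (D.cLast : ℂ) * (D.ℓ j ⬝ᵥ ((cmMatrix D.w (D.ζ x t))⁻¹ *
      (diagonal D.p * diagonal D.p) * (cmMatrix D.w (D.ζ x t))⁻¹) *ᵥ D.p)) * hE
    + (2 * (D.cLast : ℂ) ^ 2 * (D.ℓ j ⬝ᵥ ((cmMatrix D.w (D.ζ x t))⁻¹ *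
      (diagonal D.p * diagonal D.p) * (cmMatrix D.w (D.ζ x t))⁻¹) *ᵥ D.p)
      - 2 * (D.aj j - D.aLast) * (D.cLast : ℂ) ^ 2 * (D.ℓ j ⬝ᵥ ((cmMatrix D.w (D.ζ x t))⁻¹ *
      (diagonal D.p * diagonal D.p * diagonal D.p) * (cmMatrix D.w (D.ζ x t))⁻¹) *ᵥ D.p))
        * Complex.I_sq

theorem E_re (j : Fin n) : ((D.E j).re : ℂ) = D.E j := by
  rw [E_eq, Complex.ofReal_re]

theorem q₂_re (j : Fin n) : ((D.q₂ j).re : ℂ) = D.q₂ j := by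
  rw [q₂_eq, Complex.ofReal_re]

theorem F_re (j : Fin n) : ((D.F j).re : ℂ) = D.F j := by
  have hE : conj (D.E j) = D.E j := Complex.conj_eq_iff_re.2 (D.E_re j)
  have hq : ∀ k, conj (D.q₂ k) = D.q₂ k := fun k => Complex.conj_eq_iff_re.2 (D.q₂_re k)
  rw [← Complex.conj_eq_iff_re, F]
  simp only [map_add, map_neg, map_pow, map_mul, map_sum, map_ofNat, hE, hq]

/-- The plane wave factor. -/
def planeWave (j : Fin n) (x t : ℝ) : ℂ :=
  Complex.exp (Complex.I * (-(D.E j) * x + D.F j * t))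

theorem ψ_eq (j : Fin n) (x t : ℝ) :
    D.ψ j x t = (D.A j : ℂ) * Complex.exp (Complex.I * D.θ) * (D.φ j x t * D.planeWave j x t) := by
  rw [ψ, φ, planeWave, mul_assoc]

theorem norm_planeWave (j : Fin n) (x t : ℝ) : ‖D.planeWave j x t‖ = 1 := by
  rw [planeWave, ← E_re, ← F_re, mul_comm, ← Complex.ofReal_neg, ← Complex.ofReal_mul,
    ← Complex.ofReal_mul, ← Complex.ofReal_add, Complex.norm_exp_ofReal_mul_I]

theorem A_nonneg (j : Fin n) : 0 ≤ D.A j := Real.sqrt_nonneg _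

theorem A_pos (j : Fin n) : 0 < D.A j := by
  have h : D.aLast - D.aj j ≠ 0 := sub_ne_zero.2 (D.aLast_ne_aj j)
  refine Real.sqrt_pos.2 (norm_pos_iff.2 ?_)
  rw [q₂, df_eq, df_eq]
  have := D.c_ne_zero (Fin.last n)
  have := D.c_ne_zero j.castSucc
  refine one_div_ne_zero (mul_ne_zero (mul_ne_zero ?_ ?_) (pow_ne_zero _ h)) <;>
  simpa using D.c_ne_zero _

theorem norm_ψ (j : Fin n) (x t : ℝ) : ‖D.ψ j x t‖ = D.A j * ‖D.φ j x t‖ := by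
  rw [ψ_eq, norm_mul, norm_mul, norm_mul, norm_planeWave, mul_one, mul_comm Complex.I,
    Complex.norm_exp_ofReal_mul_I, mul_one, Complex.norm_real, Real.norm_eq_abs,
    abs_of_nonneg (D.A_nonneg j)]

theorem hasDerivAt_planeWave_x (j : Fin n) (x t : ℝ) :
    HasDerivAt (fun y => D.planeWave j y t) (-(Complex.I * D.E j) * D.planeWave j x t) x := by
  have h : HasDerivAt (fun y : ℝ => Complex.I * (-(D.E j) * y + D.F j * t))
      (Complex.I * (-(D.E j) * 1)) x :=
    (((Complex.ofRealCLM.hasDerivAt (x := x)).const_mul (-(D.E j))).add_const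
      (D.F j * t)).const_mul Complex.I
  exact h.cexp.congr_fun_deriv (fun _ => rfl) (by rw [planeWave]; ring)

theorem hasDerivAt_planeWave_t (j : Fin n) (x t : ℝ) :
    HasDerivAt (fun y => D.planeWave j x y) ((Complex.I * D.F j) * D.planeWave j x t) t := by
  have h : HasDerivAt (fun y : ℝ => Complex.I * (-(D.E j) * x + D.F j * y))
      (Complex.I * (D.F j * 1)) t :=
    (((Complex.ofRealCLM.hasDerivAt (x := t)).const_mul (D.F j)).const_add
      (-(D.E j) * x)).const_mul Complex.I
  exact h.cexp.congr_fun_deriv (fun _ => rfl) (by rw [planeWave]; ring)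

/-- The plane wave turns the linear equation for φ_j into one for ψ_j. The summand 2 Σ q₂ of F_j
supplies the -1 in |φ_k|² - 1, and s_k A_k² = q₂ identifies the potential. -/
theorem solvesNLS : SolvesNLS D.s D.ψ := by
  intro j x t
  set κ : ℂ := (D.A j : ℂ) * Complex.exp (Complex.I * D.θ) with hκ
  have ht : deriv (fun t' : ℝ => D.ψ j x t') t
      = κ * ((D.φt j x t + Complex.I * D.F j * D.φ j x t) * D.planeWave j x t) := by
    refine HasDerivAt.deriv ((((D.hasDerivAt_φ_t j x t).mul
      (D.hasDerivAt_planeWave_t j x t)).const_mul κ).congr_fun_deriv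
        (fun y => D.ψ_eq j x y) ?_)
    ring
  have hx : ∀ y, deriv (fun x' : ℝ => D.ψ j x' t) y
      = κ * ((D.φx j y t - Complex.I * D.E j * D.φ j y t) * D.planeWave j y t) := fun y => by
    refine HasDerivAt.deriv ((((D.hasDerivAt_φ_x j y t).mul
      (D.hasDerivAt_planeWave_x j y t)).const_mul κ).congr_fun_deriv
        (fun y => D.ψ_eq j y t) ?_)
    ring
  have hxx : iteratedDeriv 2 (fun x' : ℝ => D.ψ j x' t) x
      = κ * ((D.φxx j x t - 2 * Complex.I * D.E j * D.φx j x t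
        - D.E j ^ 2 * D.φ j x t) * D.planeWave j x t) := by
    rw [iteratedDeriv_succ, iteratedDeriv_one, funext hx]
    refine HasDerivAt.deriv (((((D.hasDerivAt_φx j x t).sub
      ((D.hasDerivAt_φ_x j x t).const_mul (Complex.I * D.E j))).mul
      (D.hasDerivAt_planeWave_x j x t)).const_mul κ).congr_fun_deriv (fun y => rfl) ?_)
    simp only [Pi.sub_apply]
    linear_combination (-κ * D.E j ^ 2 * D.φ j x t * D.planeWave j x t) * Complex.I_sq
  have hs : ((∑ k, D.s k * ‖D.ψ k x t‖ ^ 2 : ℝ) : ℂ)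
      = ∑ k, D.q₂ k * (((‖D.φ k x t‖ ^ 2 : ℝ)) : ℂ) := by
    rw [Complex.ofReal_sum]
    refine Finset.sum_congr rfl fun k _ => ?_
    rw [← s_mul_A_sq, ← Complex.ofReal_mul, norm_ψ]
    congr 1
    ring
  have hev := D.φ_evolution j x t
  simp_rw [mul_sub, Finset.sum_sub_distrib] at hev
  rw [ht, hxx, hs, ψ_eq, ← hκ]
  have hF : D.F j = -(D.E j) ^ 2 + 2 * ∑ k, D.q₂ k := rfl
  rw [hF]
  simp only [mul_one] at hev
  linear_combination (κ * D.planeWave j x t) * hev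
    + (κ * D.planeWave j x t * D.φ j x t * (-(D.E j) ^ 2 + 2 * ∑ k, D.q₂ k)) * Complex.I_sq

end BreatherData

/-! ### Degree and asymptotics of the determinants -/

section LinearDiagonal

variable {ι : Type*} [Fintype ι] [DecidableEq ι]

/-- The determinant of a Calogero–Moser matrix whose diagonal entries are `α i * X₀ + β i * X₁ + h i`
as a polynomial. -/
def cmDetPolynomial (w α β h : ι → ℂ) : MvPolynomial (Fin 2) ℂ :=
  (Matrix.of fun i k => if i = k
    then MvPolynomial.C (α i) * MvPolynomial.X 0 + MvPolynomial.C (β i) * MvPolynomial.X 1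
      + MvPolynomial.C (h i)
    else MvPolynomial.C (1 / (w i - w k))).det

theorem eval_cmDetPolynomial (w α β h : ι → ℂ) (x t : ℂ) :
    MvPolynomial.eval ![x, t] (cmDetPolynomial w α β h)
      = (cmMatrix w fun i => α i * x + β i * t + h i).det := by
  rw [cmDetPolynomial, RingHom.map_det]
  congr 1
  ext i k
  by_cases e : i = k
  · subst e; simp [cmMatrix]
  · simp [cmMatrix, e]

/-- Upper bound: every Leibniz term is a product of entries of degree at most 1. Lower bound: on the
line X₁ = 0 the top coefficient is ∏ α_i ≠ 0. -/
theorem totalDegree_cmDetPolynomial (w β h : ι → ℂ) {α : ι → ℂ} (hα : ∀ i, α i ≠ 0) :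
    (cmDetPolynomial w α β h).totalDegree = Fintype.card ι := by
  apply le_antisymm
  · rw [cmDetPolynomial, det_apply]
    refine MvPolynomial.totalDegree_finsetSum_le fun σ _ => ?_
    refine (MvPolynomial.totalDegree_smul_le _ _).trans ?_
    refine (MvPolynomial.totalDegree_finsetProd _ _).trans ?_
    refine (Finset.sum_le_card_nsmul _ _ 1 fun i _ => ?_).trans (by simp)
    rw [of_apply]
    split_ifs
    · refine (MvPolynomial.totalDegree_add _ _).trans (max_le ?_ (by simp))
      refine (MvPolynomial.totalDegree_add _ _).trans (max_le ?_ ?_) <;>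
      · refine (MvPolynomial.totalDegree_mul _ _).trans ?_
        simp
    · simp
  · by_contra! hlt
    have h1 := MvPolynomial.aeval_natDegree_le (n := 1) (cmDetPolynomial w α β h) le_rfl
      ![(Polynomial.X : Polynomial ℂ), 0] (fun i => by fin_cases i <;> simp)
    have h2 : MvPolynomial.aeval ![(Polynomial.X : Polynomial ℂ), 0] (cmDetPolynomial w α β h)
        = det ((Polynomial.X : Polynomial ℂ) • (diagonal α).map Polynomial.C
          + (cmMatrix w h).map Polynomial.C) := by
      rw [cmDetPolynomial, AlgHom.map_det]
      congr 1
      ext i k : 2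
      by_cases e : i = k
      · subst e; simp [cmMatrix]
      · simp [cmMatrix, e]
    have h3 := Polynomial.coeff_det_X_add_C_card (diagonal α) (cmMatrix w h)
    rw [← h2, Polynomial.coeff_eq_zero_of_natDegree_lt (by omega), det_diagonal] at h3
    exact Finset.prod_ne_zero_iff.2 (fun i _ => hα i) h3.symm

/-- With the growing diagonal factored out, the remaining matrix tends to 1. -/
theorem tendsto_det_cmMatrix_div {X : Type*} {l : Filter X} {ζ : X → ι → ℂ}
    (hζ : ∀ i, Filter.Tendsto (fun p => ζ p i) l (Bornology.cobounded ℂ)) (w h : ι → ℂ) :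
    Filter.Tendsto (fun p => (cmMatrix w (ζ p + h)).det / ∏ i, ζ p i) l (nhds 1) := by
  have hne : ∀ᶠ p in l, ∀ i, ζ p i ≠ 0 :=
    Filter.eventually_all.2 fun i => (hζ i).eventually (Bornology.eventually_ne_cobounded 0)
  have hε : Filter.Tendsto (fun p i => (ζ p i)⁻¹) l (nhds (0 : ι → ℂ)) :=
    tendsto_pi_nhds.2 fun i => Filter.tendsto_inv₀_cobounded.comp (hζ i)
  have hc : Continuous fun ε : ι → ℂ => (1 + diagonal ε * cmMatrix w h).det := by
    refine Continuous.matrix_det (continuous_const.add ?_)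
    exact (continuous_id.matrix_diagonal).matrix_mul continuous_const
  have hlim := (hc.tendsto 0).comp hε
  have h0 : (1 + diagonal (0 : ι → ℂ) * cmMatrix w h).det = 1 := by
    rw [show (diagonal (0 : ι → ℂ)) = 0 from diagonal_zero, zero_mul, add_zero, det_one]
  rw [h0] at hlim
  refine hlim.congr' ?_
  filter_upwards [hne] with p hp
  have hprod : ∏ i, ζ p i ≠ 0 := Finset.prod_ne_zero_iff.2 fun i _ => hp i
  have e : cmMatrix w (ζ p + h)
      = diagonal (ζ p) * (1 + diagonal (fun i => (ζ p i)⁻¹) * cmMatrix w h) := by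
    rw [mul_add, ← mul_assoc, diagonal_mul_diagonal, mul_one, add_comm (ζ p), cmMatrix_add,
      add_comm]
    simp [hp]
  rw [e, det_mul, det_diagonal, mul_div_cancel_left₀ _ hprod]
  rfl

end LinearDiagonal

/-- An injective real linear map from ℝ² to ℂ is a closed embedding, hence proper. -/
theorem tendsto_affine_cobounded {α β : ℂ} (h : ∀ x t : ℝ, α * x + β * t = 0 → x = 0 ∧ t = 0)
    (d : ℂ) : Filter.Tendsto (fun p : ℝ × ℝ => α * p.1 + β * p.2 - d)
      (Filter.cocompact (ℝ × ℝ)) (Bornology.cobounded ℂ) := by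
  let L : ℝ × ℝ →ₗ[ℝ] ℂ :=
    { toFun := fun p => α * p.1 + β * p.2
      map_add' := fun p q => by simp; ring
      map_smul' := fun r p => by simp; ring }
  have hL : LinearMap.ker L = ⊥ := by
    rw [LinearMap.ker_eq_bot']
    intro p hp
    obtain ⟨h1, h2⟩ := h p.1 p.2 hp
    exact Prod.ext h1 h2
  have h1 := (LinearMap.isClosedEmbedding_of_injective hL).tendsto_cocompact
  rw [Metric.cobounded_eq_cocompact]
  exact ((Homeomorph.subRight d).isClosedEmbedding.tendsto_cocompact).comp h1

/-- A function with a limit at infinity which is periodic is constant. -/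
theorem eq_limit_of_periodic {E Y : Type*} [NormedAddCommGroup E] [NormedSpace ℝ E]
    [TopologicalSpace Y] [T2Space Y] {f : E → Y} {A : Y}
    (hf : Filter.Tendsto f (Filter.cocompact E) (nhds A)) {v : E} (hv : v ≠ 0)
    (hper : ∀ q, f (q + v) = f q) (q : E) : f q = A := by
  have h1 : Filter.Tendsto (fun m : ℕ => (m : ℝ)) Filter.atTop (Filter.cocompact ℝ) :=
    tendsto_natCast_atTop_atTop.mono_right atTop_le_cocompact
  have h2 : Filter.Tendsto (fun m : ℕ => q + (m : ℝ) • v) Filter.atTop (Filter.cocompact E) :=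
    ((Homeomorph.addLeft q).isClosedEmbedding.tendsto_cocompact).comp
      (((isClosedEmbedding_smul_left hv).tendsto_cocompact).comp h1)
  have h3 : ∀ m : ℕ, f (q + (m : ℝ) • v) = f q := by
    intro m
    induction m with
    | zero => simp
    | succ m ih =>
      rw [← ih, ← hper (q + (m : ℝ) • v)]
      congr 1
      push_cast
      rw [add_smul, one_smul, add_assoc]
  have h4 := hf.comp h2
  exact tendsto_nhds_unique (tendsto_const_nhds.congr fun m => (h3 m).symm) h4

/-! ### Behaviour at infinity and absence of periods -/

namespace BreatherData

variable {n N : ℕ} (D : BreatherData n N)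

theorem p_ne_zero (i : Fin N ⊕ Fin N) : D.p i ≠ 0 :=
  one_div_ne_zero (sub_ne_zero.2 (D.w_ne_aLast i))

theorem ℓ_ne_zero (j : Fin n) (i : Fin N ⊕ Fin N) : D.ℓ j i ≠ 0 :=
  one_div_ne_zero (sub_ne_zero.2 (D.w_ne_aj j i))

theorem p_injective : Function.Injective D.p := by
  intro i k h
  simp only [p, poleVec, one_div, _root_.inv_inj, sub_left_inj] at h
  exact D.w_injective h

theorem p_im_ne_zero (i : Fin N ⊕ Fin N) : (D.p i).im ≠ 0 := by
  rw [Ne, ← Complex.conj_eq_iff_im]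
  intro h
  have h1 : conj (D.p i) = D.p i.swap := D.conj_poleVec _ i
  rw [h1] at h
  rcases i with k | k
  · exact Sum.inr_ne_inl (D.p_injective h)
  · exact Sum.inl_ne_inr (D.p_injective h)

theorem cLast_ne_zero : (D.cLast : ℂ) ≠ 0 := Complex.ofReal_ne_zero.2 (D.c_ne_zero _)

/-- Division by i c p_i² leaves x + 2c t p_i = 0, and p_i is not real. -/
theorem linear_part_injective (i : Fin N ⊕ Fin N) (x t : ℝ)
    (h : Complex.I * D.cLast * D.p i ^ 2 * x + 2 * Complex.I * D.cLast ^ 2 * D.p i ^ 3 * t = 0) :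
    x = 0 ∧ t = 0 := by
  have h1 : Complex.I * D.cLast * D.p i ^ 2 ≠ 0 :=
    mul_ne_zero (mul_ne_zero Complex.I_ne_zero D.cLast_ne_zero) (pow_ne_zero _ (D.p_ne_zero i))
  have h2 : (x : ℂ) + ((2 * D.cLast * t : ℝ) : ℂ) * D.p i = 0 := by
    apply (mul_right_injective₀ h1)
    simp only [mul_zero]
    rw [← h]
    push_cast
    ring
  have h3 := congrArg Complex.im h2
  rw [Complex.add_im, Complex.ofReal_im, zero_add, Complex.im_ofReal_mul, Complex.zero_im] at h3
  have h4 : t = 0 := by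
    have := (mul_eq_zero.1 h3).resolve_right (D.p_im_ne_zero i)
    simpa [D.c_ne_zero] using this
  refine ⟨?_, h4⟩
  rw [h4] at h2
  simpa using h2

theorem tendsto_ζ (i : Fin N ⊕ Fin N) :
    Filter.Tendsto (fun q : ℝ × ℝ => D.ζ q.1 q.2 i) (Filter.cocompact (ℝ × ℝ))
      (Bornology.cobounded ℂ) :=
  tendsto_affine_cobounded (D.linear_part_injective i) (D.δ i)

theorem tendsto_φ (j : Fin n) :
    Filter.Tendsto (fun q : ℝ × ℝ => D.φ j q.1 q.2) (Filter.cocompact (ℝ × ℝ)) (nhds 1) := by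
  have h1 := tendsto_det_cmMatrix_div D.tendsto_ζ D.w (D.ℓ j - D.p)
  have h2 := tendsto_det_cmMatrix_div D.tendsto_ζ D.w 0
  have h3 := h1.div h2 one_ne_zero
  rw [div_one] at h3
  refine h3.congr' ?_
  have hne : ∀ᶠ q : ℝ × ℝ in Filter.cocompact (ℝ × ℝ), ∀ i, D.ζ q.1 q.2 i ≠ 0 :=
    Filter.eventually_all.2 fun i =>
      (D.tendsto_ζ i).eventually (Bornology.eventually_ne_cobounded 0)
  filter_upwards [hne] with q hq
  have hprod : ∏ i, D.ζ q.1 q.2 i ≠ 0 := Finset.prod_ne_zero_iff.2 fun i _ => hq i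
  rw [φ_eq_div, Pi.div_apply, add_zero, div_div_div_cancel_right₀ hprod]
  rfl

theorem tendsto_norm_ψ (j : Fin n) :
    Filter.Tendsto (fun q : ℝ × ℝ => ‖D.ψ j q.1 q.2‖) (Filter.cocompact (ℝ × ℝ))
      (nhds (D.A j)) := by
  have h := ((D.tendsto_φ j).norm).const_mul (D.A j)
  rw [norm_one, mul_one] at h
  exact h.congr fun q => (D.norm_ψ j q.1 q.2).symm

theorem contDiff_det_cmMatrix (g : Fin N ⊕ Fin N → ℂ) :
    ContDiff ℝ ∞ fun q : ℝ × ℝ => (cmMatrix D.w (D.ζ q.1 q.2 + g)).det := by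
  have hof : ∀ {f : ℝ × ℝ → ℝ}, ContDiff ℝ ∞ f → ContDiff ℝ ∞ fun q => (f q : ℂ) :=
    fun hf => Complex.ofRealCLM.contDiff.comp hf
  simp_rw [det_apply]
  refine ContDiff.sum fun σ _ => ContDiff.const_smul _ (contDiff_prod fun i _ => ?_)
  by_cases h : σ i = i
  · simp only [cmMatrix, of_apply, h, if_true, Pi.add_apply, ζ]
    exact (((contDiff_const.mul (hof contDiff_fst)).add
      (contDiff_const.mul (hof contDiff_snd))).sub contDiff_const).add contDiff_const
  · simp only [cmMatrix, of_apply, h, if_false]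
    exact contDiff_const

theorem contDiff_ψ (j : Fin n) : ContDiff ℝ ∞ fun q : ℝ × ℝ => D.ψ j q.1 q.2 := by
  have hof : ∀ {f : ℝ × ℝ → ℝ}, ContDiff ℝ ∞ f → ContDiff ℝ ∞ fun q => (f q : ℂ) :=
    fun hf => Complex.ofRealCLM.contDiff.comp hf
  simp_rw [ψ_eq, φ_eq_div, planeWave, div_eq_mul_inv]
  refine contDiff_const.mul (((D.contDiff_det_cmMatrix _).mul (ContDiff.inv ?_ ?_)).mul ?_)
  · simpa [G] using D.contDiff_det_cmMatrix 0
  · exact fun q => D.det_G_ne_zero q.1 q.2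
  · exact (contDiff_const.mul ((contDiff_const.mul (hof contDiff_fst)).add
      (contDiff_const.mul (hof contDiff_snd)))).cexp

/-- If |φ_j| ≡ 1, the form ℓ_jᵀYR²Yℓ_j vanishes identically. Cleared of denominators by adjugates,
its leading part along the rays (sy, s) is a polynomial in y that must vanish too; a root of the
diagonal entry with index i₀ leaves a single nonzero summand. -/
theorem exists_norm_φ_ne_one (j : Fin n) (i₀ : Fin N ⊕ Fin N) :
    ∃ x t : ℝ, ‖D.φ j x t‖ ≠ 1 := by
  by_contra! hcon
  have hδ : (D.aj j - D.aLast) ^ 2 ≠ 0 :=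
    pow_ne_zero _ (sub_ne_zero.2 (D.aLast_ne_aj j).symm)
  have hadj : ∀ x t : ℝ, D.ℓ j ⬝ᵥ ((D.G x t).adjugate * (diagonal D.p * diagonal D.p)
      * (D.G x t).adjugate) *ᵥ D.ℓ j = 0 := by
    intro x t
    have h := D.norm_φ_sq j x t
    rw [hcon, one_pow, Complex.ofReal_one, sub_self, eq_comm, neg_eq_zero] at h
    have h' := (mul_eq_zero.1 h).resolve_left hδ
    rw [inv_def] at h'
    simp only [smul_mul_assoc, mul_smul_comm, smul_mulVec, dotProduct_smul, smul_eq_mul,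
      Ring.inverse_eq_inv', mul_eq_zero, inv_eq_zero, D.det_G_ne_zero x t, false_or] at h'
    exact h'
  -- `L y` is the rate of growth of the diagonal along (sy, s). With ε = 1/s, letting ε → 0 removes
  -- the constant matrix `M`.
  set L : ℝ → Fin N ⊕ Fin N → ℂ := fun y i =>
    Complex.I * D.cLast * D.p i ^ 2 * (y + 2 * D.cLast * D.p i) with hL
  set M := cmMatrix D.w (-D.δ) with hM
  have hGs : ∀ (y : ℝ) (s : ℝ), s ≠ 0 →
      D.G (s * y) s = (s : ℂ) • (diagonal (L y) + (s : ℂ)⁻¹ • M) := by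
    intro y s hs
    have hs' : (s : ℂ) ≠ 0 := Complex.ofReal_ne_zero.2 hs
    have e : D.ζ (s * y) s = -D.δ + (s : ℂ) • L y := by
      ext i
      simp only [ζ, hL, Pi.add_apply, Pi.neg_apply, Pi.smul_apply, smul_eq_mul]
      push_cast
      ring
    rw [G, e, cmMatrix_add, smul_add, smul_smul, mul_inv_cancel₀ hs', one_smul, add_comm,
      diagonal_smul]
  have hε : ∀ y ε : ℝ, ε ≠ 0 → D.ℓ j ⬝ᵥ ((diagonal (L y) + (ε : ℂ) • M).adjugate *
      (diagonal D.p * diagonal D.p) * (diagonal (L y) + (ε : ℂ) • M).adjugate) *ᵥ D.ℓ j = 0 := by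
    intro y ε hε
    have h := hadj (ε⁻¹ * y) ε⁻¹
    rw [hGs y _ (inv_ne_zero hε), adjugate_smul, Complex.ofReal_inv, inv_inv] at h
    simp only [smul_mul_assoc, mul_smul_comm, smul_mulVec, dotProduct_smul, smul_eq_mul,
      mul_eq_zero] at h
    have h0 : ((ε : ℂ)⁻¹) ^ (Fintype.card (Fin N ⊕ Fin N) - 1) ≠ 0 :=
      pow_ne_zero _ (inv_ne_zero (Complex.ofReal_ne_zero.2 hε))
    exact (h.resolve_left h0).resolve_left h0
  have hzero : ∀ y : ℝ, D.ℓ j ⬝ᵥ ((diagonal (L y)).adjugate *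
      (diagonal D.p * diagonal D.p) * (diagonal (L y)).adjugate) *ᵥ D.ℓ j = 0 := by
    intro y
    have hc : Continuous fun ε : ℝ => D.ℓ j ⬝ᵥ ((diagonal (L y) + (ε : ℂ) • M).adjugate *
      (diagonal D.p * diagonal D.p) * (diagonal (L y) + (ε : ℂ) • M).adjugate) *ᵥ D.ℓ j := by
      have h1 : Continuous fun ε : ℝ => (diagonal (L y) + (ε : ℂ) • M).adjugate :=
        (continuous_const.add (Complex.continuous_ofReal.smul continuous_const)).matrix_adjugate
      exact continuous_const.dotProduct
        (((h1.matrix_mul continuous_const).matrix_mul h1).matrix_mulVec continuous_const)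
    have hd : Dense ({0}ᶜ : Set ℝ) := dense_compl_singleton 0
    have := hc.ext_on hd continuous_const (fun ε hε' => hε y ε hε')
    simpa using congrFun this 0
  let P : Polynomial ℂ := ∑ i, Polynomial.C (D.ℓ j i ^ 2 * D.p i ^ 2) *
    (∏ k ∈ Finset.univ.erase i, Polynomial.C (Complex.I * D.cLast * D.p k ^ 2)
      * (Polynomial.X + Polynomial.C (2 * D.cLast * D.p k))) ^ 2
  have hPeval : ∀ y : ℂ, P.eval y = ∑ i, D.ℓ j i ^ 2 * D.p i ^ 2 *
      (∏ k ∈ Finset.univ.erase i, Complex.I * D.cLast * D.p k ^ 2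
        * (y + 2 * D.cLast * D.p k)) ^ 2 := by
    intro y
    simp [P, Polynomial.eval_finsetSum, Polynomial.eval_prod]
  have hPreal : ∀ y : ℝ, P.eval (y : ℂ) = 0 := by
    intro y
    rw [hPeval, ← hzero y]
    simp only [adjugate_diagonal, diagonal_mul_diagonal, mulVec_diagonal, dotProduct, hL]
    refine Finset.sum_congr rfl fun i _ => ?_
    ring
  have hP : P = 0 := by
    refine Polynomial.eq_zero_of_infinite_isRoot P ?_
    refine (Set.infinite_range_of_injective Complex.ofReal_injective).mono ?_
    rintro _ ⟨y, rfl⟩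
    exact hPreal y
  -- The polynomial vanishes on ℝ, hence everywhere, so y may be the non-real root of the entry
  -- `i₀`. All other summands contain that entry, and the surviving product is nonzero because p is
  -- injective.
  have h := hPeval (-(2 * D.cLast * D.p i₀))
  rw [hP, Polynomial.eval_zero, Finset.sum_eq_single i₀] at h
  · refine absurd h.symm (mul_ne_zero (mul_ne_zero (pow_ne_zero _ (D.ℓ_ne_zero j i₀))
      (pow_ne_zero _ (D.p_ne_zero i₀))) (pow_ne_zero _ (Finset.prod_ne_zero_iff.2 ?_)))
    intro k hk
    have hk' : D.p k - D.p i₀ ≠ 0 :=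
      sub_ne_zero.2 fun e => (Finset.mem_erase.1 hk).1 (D.p_injective e)
    have e : -(2 * (D.cLast : ℂ) * D.p i₀) + 2 * D.cLast * D.p k
        = 2 * D.cLast * (D.p k - D.p i₀) := by ring
    rw [e]
    exact mul_ne_zero (mul_ne_zero (mul_ne_zero Complex.I_ne_zero D.cLast_ne_zero)
      (pow_ne_zero _ (D.p_ne_zero k))) (mul_ne_zero (mul_ne_zero two_ne_zero D.cLast_ne_zero) hk')
  · intro i _ hi
    rw [Finset.prod_eq_zero (Finset.mem_erase.2 ⟨hi.symm, Finset.mem_univ i₀⟩)]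
    · simp
    · simp
  · simp

theorem not_periodic_norm_ψ (hN : 1 ≤ N) (j : Fin n) {v : ℝ × ℝ} (hv : v ≠ 0) :
    ¬ ∀ q : ℝ × ℝ, ‖D.ψ j (q + v).1 (q + v).2‖ = ‖D.ψ j q.1 q.2‖ := by
  intro hper
  obtain ⟨x, t, hxt⟩ := D.exists_norm_φ_ne_one j (Sum.inl ⟨0, hN⟩)
  have h := eq_limit_of_periodic (D.tendsto_norm_ψ j) hv hper (x, t)
  simp only [norm_ψ] at h
  exact hxt (mul_left_cancel₀ (D.A_pos j).ne' (h.trans (mul_one _).symm))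

theorem s_eq (j : Fin n) : D.s j = 1 ∨ D.s j = -1 := by
  rw [s, df_eq, df_eq, ← Complex.ofReal_mul, Complex.ofReal_re]
  exact (Real.sign_apply_eq_of_ne_zero _ (mul_ne_zero (inv_ne_zero (D.c_ne_zero _))
    (inv_ne_zero (D.c_ne_zero _)))).symm

theorem isRationalBreather (hN : 1 ≤ N) : IsRationalBreather N D.s D.ψ where
  sign := D.s_eq
  smooth := D.contDiff_ψ
  solves := D.solvesNLS
  rational := by
    set α : Fin N ⊕ Fin N → ℂ := fun i => Complex.I * D.cLast * D.p i ^ 2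
    set β : Fin N ⊕ Fin N → ℂ := fun i => 2 * Complex.I * D.cLast ^ 2 * D.p i ^ 3
    have hα : ∀ i, α i ≠ 0 := fun i =>
      mul_ne_zero (mul_ne_zero Complex.I_ne_zero D.cLast_ne_zero) (pow_ne_zero _ (D.p_ne_zero i))
    have hcard : Fintype.card (Fin N ⊕ Fin N) = 2 * N := by simp [two_mul]
    have hQ : ∀ x t : ℝ, MvPolynomial.eval ![(x : ℂ), (t : ℂ)] (cmDetPolynomial D.w α β (-D.δ))
        = (D.G x t).det := by
      intro x t
      rw [eval_cmDetPolynomial]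
      rfl
    have hκ : ∀ j, (D.A j : ℂ) * Complex.exp (Complex.I * D.θ) ≠ 0 := fun j =>
      mul_ne_zero (Complex.ofReal_ne_zero.2 (D.A_pos j).ne') (Complex.exp_ne_zero _)
    refine ⟨cmDetPolynomial D.w α β (-D.δ),
      fun j => MvPolynomial.C ((D.A j : ℂ) * Complex.exp (Complex.I * D.θ))
        * cmDetPolynomial D.w α β (-D.δ + (D.ℓ j - D.p)),
      fun j => (D.E j).re, fun j => (D.F j).re, ?_, fun j => ?_, fun x t => ?_, fun j x t => ?_⟩
    · rw [totalDegree_cmDetPolynomial _ _ _ hα, hcard]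
    · have hd := totalDegree_cmDetPolynomial D.w β (-D.δ + (D.ℓ j - D.p)) hα
      rw [MvPolynomial.totalDegree_mul_of_isDomain, MvPolynomial.totalDegree_C, hd, hcard,
        zero_add]
      · simpa using hκ j
      · intro h0
        rw [h0, MvPolynomial.totalDegree_zero, hcard] at hd
        omega
    · rw [hQ]
      exact D.det_G_ne_zero x t
    · have hP : (cmMatrix D.w fun i => α i * x + β i * t + (-D.δ + (D.ℓ j - D.p)) i)
          = cmMatrix D.w (D.ζ x t + (D.ℓ j - D.p)) := by
        congr 1
        ext i
        simp only [α, β, ζ, Pi.add_apply, Pi.neg_apply]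
        ring
      rw [hQ, map_mul, MvPolynomial.eval_C, eval_cmDetPolynomial, hP, E_re, F_re, ψ_eq, φ_eq_div,
        planeWave]
      ring
  isolated := fun j => ⟨D.A j, D.A_pos j, D.tendsto_norm_ψ j⟩
  not_periodic_space := fun j T hT h =>
    D.not_periodic_norm_ψ hN j (v := (T, 0)) (by simpa using hT) fun q => by simpa using h q.1 q.2
  not_periodic_time := fun j T hT h =>
    D.not_periodic_norm_ψ hN j (v := (0, T)) (by simpa using hT) fun q => by simpa using h q.1 q.2

end BreatherData

/-! ### Comparison with the Peregrine profile, N = 1 -/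

theorem exists_affineEquiv_re_im_half {α β : ℂ}
    (h : ∀ x t : ℝ, α * x + β * t = 0 → x = 0 ∧ t = 0) (d : ℂ) :
    ∃ L : (ℝ × ℝ) ≃ᵃ[ℝ] (ℝ × ℝ), ∀ x t : ℝ,
      L (x, t) = ((α * x + β * t - d).re, (α * x + β * t - d).im / 2) := by
  let M : ℝ × ℝ →ₗ[ℝ] ℝ × ℝ :=
    { toFun := fun q => ((α * q.1 + β * q.2).re, (α * q.1 + β * q.2).im / 2)
      map_add' := fun q r => by ext <;> simp <;> ring
      map_smul' := fun r q => by ext <;> simp <;> ring }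
  have hM : Function.Injective M := by
    rw [injective_iff_map_eq_zero]
    intro q hq
    have h1 : (α * q.1 + β * q.2).re = 0 := congrArg Prod.fst hq
    have h2 : (α * q.1 + β * q.2).im / 2 = 0 := congrArg Prod.snd hq
    obtain ⟨h3, h4⟩ := h q.1 q.2 (Complex.ext h1 (by simpa using h2))
    exact Prod.ext h3 h4
  refine ⟨(LinearEquiv.ofInjectiveEndo M hM).toAffineEquiv.trans
    (AffineEquiv.constVAdd ℝ (ℝ × ℝ) (-d.re, -d.im / 2)), fun x t => ?_⟩
  have : LinearEquiv.ofInjectiveEndo M hM (x, t)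
      = ((α * x + β * t).re, (α * x + β * t).im / 2) := rfl
  rw [AffineEquiv.trans_apply, LinearEquiv.coe_toAffineEquiv, this, AffineEquiv.constVAdd_apply,
    vadd_eq_add, Prod.mk_add_mk, Complex.sub_re, Complex.sub_im]
  ext <;> ring

/-- The Peregrine breather has a zero, so that a function without zeros cannot have its profile. -/
theorem not_hasPeregrineProfile_of_ne_zero {f : ℝ → ℝ → ℂ} (hf : ∀ x t, f x t ≠ 0) :
    ¬ HasPeregrineProfile f := by
  rintro ⟨c, L, -, h⟩
  -- At t = 0 the zero condition is 1 + 4x² = 4.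
  have h0 : peregrine (Real.sqrt 3 / 2) 0 = 0 := by
    have : ((Real.sqrt 3 : ℝ) : ℂ) ^ 2 = 3 := by
      rw [← Complex.ofReal_pow, Real.sq_sqrt (by norm_num)]
      norm_num
    rw [peregrine, Complex.ofReal_div, div_pow, this]
    norm_num
  have h1 := h (L.symm (Real.sqrt 3 / 2, 0)).1 (L.symm (Real.sqrt 3 / 2, 0)).2
  rw [Prod.mk.eta, AffineEquiv.apply_symm_apply, h0, norm_zero, mul_zero, norm_eq_zero] at h1
  exact hf _ _ h1

namespace BreatherData

variable {n : ℕ} (D : BreatherData n 1)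

theorem det_cmMatrix_one (g : Fin 1 ⊕ Fin 1 → ℂ) :
    (cmMatrix D.w g).det
      = g (Sum.inl 0) * g (Sum.inr 0) + 1 / (D.u 0 - conj (D.u 0)) ^ 2 := by
  rw [← det_reindex_self finSumFinEquiv, det_fin_two]
  have h0 : finSumFinEquiv.symm (0 : Fin (1 + 1)) = (Sum.inl 0 : Fin 1 ⊕ Fin 1) := rfl
  have h1 : finSumFinEquiv.symm (1 : Fin (1 + 1)) = (Sum.inr 0 : Fin 1 ⊕ Fin 1) := rfl
  simp only [reindex_apply, submatrix_apply, h0, h1, cmMatrix, of_apply, if_true, reduceCtorEq,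
    if_false, w, Sum.elim_inl, Sum.elim_inr]
  rw [← neg_sub (D.u 0) (conj (D.u 0)), div_neg, mul_neg, sub_neg_eq_add, one_div_mul_one_div, sq]

/-- The shift of the diagonal in the numerator of the wave function. -/
abbrev ρ (j : Fin n) : ℂ := 1 / (D.u 0 - D.aj j) - 1 / (D.u 0 - D.aLast)

theorem det_G_one (x t : ℝ) : (D.G x t).det
    = -(D.ζ x t (Sum.inl 0) * conj (D.ζ x t (Sum.inl 0)))
      + 1 / (D.u 0 - conj (D.u 0)) ^ 2 := by
  rw [G, det_cmMatrix_one, D.conj_ζ x t (Sum.inl 0), Sum.swap_inl, mul_neg, neg_neg]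

theorem det_shifted_one (j : Fin n) (x t : ℝ) :
    (cmMatrix D.w (D.ζ x t + (D.ℓ j - D.p))).det
      = (D.ζ x t (Sum.inl 0) + D.ρ j) * (-conj (D.ζ x t (Sum.inl 0)) + conj (D.ρ j))
        + 1 / (D.u 0 - conj (D.u 0)) ^ 2 := by
  have cL : conj D.aLast = D.aLast := Complex.conj_ofReal _
  have cj : conj (D.aj j) = D.aj j := Complex.conj_ofReal _
  rw [det_cmMatrix_one, D.conj_ζ x t (Sum.inl 0), Sum.swap_inl, neg_neg]
  simp [ρ, poleVec, w, cL, cj]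

theorem sub_conj_u (k : Fin 1) : D.u k - conj (D.u k) ≠ 0 := by
  intro h
  exact D.u_im_ne_zero k (Complex.conj_eq_iff_im.1 (sub_eq_zero.1 h).symm)

/-- The real part of the numerator is |ρ|² - |ζ|² - 1/(2 Im u)², which the hypothesis makes
negative. -/
theorem ψ_ne_zero_of_norm_ρ_lt {j : Fin n} (h : (2 * (D.u 0).im) ^ 2 * Complex.normSq (D.ρ j) < 1)
    (x t : ℝ) : D.ψ j x t ≠ 0 := by
  rw [← norm_ne_zero_iff, norm_ψ]
  refine mul_ne_zero (D.A_pos j).ne' (norm_ne_zero_iff.2 ?_)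
  rw [φ_eq_div]
  refine div_ne_zero ?_ (D.det_G_ne_zero x t)
  rw [det_shifted_one]
  intro h0
  have hu : D.u 0 - conj (D.u 0) = ((2 * (D.u 0).im : ℝ) : ℂ) * Complex.I := by
    rw [Complex.sub_conj]
  have h1 : 1 / (D.u 0 - conj (D.u 0)) ^ 2 = ((-(1 / (2 * (D.u 0).im) ^ 2) : ℝ) : ℂ) := by
    rw [hu, mul_pow, Complex.I_sq]
    push_cast
    rw [mul_neg_one, div_neg]
  have h2 := congrArg Complex.re h0
  rw [h1, Complex.add_re, Complex.ofReal_re, Complex.mul_re, Complex.zero_re] at h2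
  simp only [Complex.add_re, Complex.add_im, Complex.neg_re, Complex.neg_im, Complex.conj_re,
    Complex.conj_im] at h2
  have him : 0 < (2 * (D.u 0).im) ^ 2 := by
    have := D.u_im_ne_zero 0
    positivity
  have h3 : Complex.normSq (D.ρ j) < 1 / (2 * (D.u 0).im) ^ 2 := by
    rw [lt_div_iff₀ him, mul_comm]
    exact h
  rw [Complex.normSq_apply] at h3
  nlinarith [mul_self_nonneg (D.ζ x t (Sum.inl 0)).re, mul_self_nonneg (D.ζ x t (Sum.inl 0)).im]

end BreatherData

section Scalar

variable (D : BreatherData 1 1)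

namespace BreatherData

theorem scalar_critical :
    (D.c 0 : ℂ) * (D.u 0 - D.aLast) ^ 2 + D.c 1 * (D.u 0 - D.aj 0) ^ 2 = 0 := by
  have h := D.w_critical (Sum.inl 0)
  rw [Fin.sum_univ_two] at h
  have h1 : D.u 0 - D.aj 0 ≠ 0 := sub_ne_zero.2 (D.w_ne_aj 0 (Sum.inl 0))
  have h2 : D.u 0 - D.aLast ≠ 0 := sub_ne_zero.2 (D.w_ne_aLast (Sum.inl 0))
  replace h : (D.c 0 : ℂ) * (1 / (D.u 0 - D.aj 0) ^ 2)
      + D.c 1 * (1 / (D.u 0 - D.aLast) ^ 2) = 0 := h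
  field_simp at h
  linear_combination h

/-- The zeros of `f` are seen from a critical point under a right angle. -/
theorem scalar_right_angle :
    (D.u 0 - D.aLast) * (conj (D.u 0) - D.aj 0)
      + (conj (D.u 0) - D.aLast) * (D.u 0 - D.aj 0) = 0 := by
  have cL : conj D.aLast = D.aLast := Complex.conj_ofReal _
  have cj : conj (D.aj 0) = D.aj 0 := Complex.conj_ofReal _
  have h := D.scalar_critical
  have h' := congrArg conj h
  simp only [map_add, map_mul, map_pow, map_sub, Complex.conj_ofReal, cL, cj, map_zero] at h'
  have hc : (D.c 0 : ℂ) ≠ 0 := Complex.ofReal_ne_zero.2 (D.c_ne_zero 0)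
  -- Eliminating c₁ between the critical point equation and its conjugate leaves a difference of two
  -- squares; one factor is (a_{n+1} - a_j)(u - ū) ≠ 0.
  have hprod : (D.c 0 : ℂ) * (((D.u 0 - D.aLast) * (conj (D.u 0) - D.aj 0)
      - (conj (D.u 0) - D.aLast) * (D.u 0 - D.aj 0))
      * ((D.u 0 - D.aLast) * (conj (D.u 0) - D.aj 0)
      + (conj (D.u 0) - D.aLast) * (D.u 0 - D.aj 0))) = 0 := by
    linear_combination (conj (D.u 0) - D.aj 0) ^ 2 * h - (D.u 0 - D.aj 0) ^ 2 * h'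
  refine ((mul_eq_zero.1 ((mul_eq_zero.1 hprod).resolve_left hc)).resolve_left ?_)
  have e : (D.u 0 - D.aLast) * (conj (D.u 0) - D.aj 0)
      - (conj (D.u 0) - D.aLast) * (D.u 0 - D.aj 0)
      = (D.aLast - D.aj 0) * (D.u 0 - conj (D.u 0)) := by ring
  rw [e]
  exact mul_ne_zero (sub_ne_zero.2 (D.aLast_ne_aj 0)) (D.sub_conj_u 0)

/-- By the right angle X is purely imaginary, so c₀ X² + c₁ |u - a_j|⁴ = 0 forces c₀ and c₁ to have
the same sign. -/
theorem scalar_sign : D.s 0 = 1 := by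
  have cj : conj (D.aj 0) = D.aj 0 := Complex.conj_ofReal _
  have cL : conj D.aLast = D.aLast := Complex.conj_ofReal _
  have hb : D.u 0 - D.aj 0 ≠ 0 := sub_ne_zero.2 (D.w_ne_aj 0 (Sum.inl 0))
  have h := D.scalar_critical
  have hX := D.scalar_right_angle
  set X := (D.u 0 - D.aLast) * (conj (D.u 0) - D.aj 0) with hXdef
  have hre : X.re = 0 := by
    have e : X + conj X = 0 := by
      rw [← hX, hXdef]
      simp only [map_mul, map_sub, Complex.conj_conj, cL, cj]
    rw [Complex.add_conj] at e
    have := Complex.ofReal_eq_zero.1 e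
    linarith
  have hXI : X = X.im * Complex.I := by
    conv_lhs => rw [← Complex.re_add_im X, hre, Complex.ofReal_zero, zero_add]
  have hn : (D.u 0 - D.aj 0) * (conj (D.u 0) - D.aj 0) = (Complex.normSq (D.u 0 - D.aj 0) : ℂ) := by
    rw [← Complex.mul_conj, map_sub, cj]
  have hreal : D.c 0 * (-X.im ^ 2) + D.c 1 * Complex.normSq (D.u 0 - D.aj 0) ^ 2 = 0 := by
    rw [← Complex.ofReal_inj]
    push_cast
    rw [← hn]
    have hsq : X ^ 2 = -(X.im : ℂ) ^ 2 := by
      conv_lhs => rw [hXI, mul_pow, Complex.I_sq]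
      ring
    rw [← hsq, hXdef]
    linear_combination (conj (D.u 0) - D.aj 0) ^ 2 * h
  have hpos : 0 < Complex.normSq (D.u 0 - D.aj 0) := Complex.normSq_pos.2 hb
  have h0 := D.c_ne_zero 0
  have h1 := D.c_ne_zero 1
  have hcc : 0 < D.c 1 * D.c 0 := by
    by_contra! hle
    have h2 : 0 < D.c 1 ^ 2 * Complex.normSq (D.u 0 - D.aj 0) ^ 2 := by positivity
    have h3 := congrArg (fun y => D.c 1 * y) hreal
    simp only [mul_zero] at h3
    have h4 := mul_nonneg (neg_nonneg.2 hle) (sq_nonneg X.im)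
    linarith
  have hs : D.s 0 = Real.sign ((D.c 1)⁻¹ * (D.c 0)⁻¹) := by
    rw [s, df_eq, df_eq, ← Complex.ofReal_mul, Complex.ofReal_re]
    rfl
  rw [hs, ← mul_inv, Real.sign_of_pos (inv_pos.2 hcc)]

/-- For X = (u - a_{n+1})(ū - a_j) the left side is (X - X̄)²/(X X̄), and X̄ = -X. -/
theorem scalar_norm_ρ :
    D.ρ 0 * conj (D.ρ 0) * (D.u 0 - conj (D.u 0)) ^ 2 = -4 := by
  have cj : conj (D.aj 0) = D.aj 0 := Complex.conj_ofReal _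
  have cL : conj D.aLast = D.aLast := Complex.conj_ofReal _
  have h1 : D.u 0 - D.aj 0 ≠ 0 := sub_ne_zero.2 (D.w_ne_aj 0 (Sum.inl 0))
  have h2 : D.u 0 - D.aLast ≠ 0 := sub_ne_zero.2 (D.w_ne_aLast (Sum.inl 0))
  have h3 : conj (D.u 0) - D.aj 0 ≠ 0 := sub_ne_zero.2 (D.w_ne_aj 0 (Sum.inr 0))
  have h4 : conj (D.u 0) - D.aLast ≠ 0 := sub_ne_zero.2 (D.w_ne_aLast (Sum.inr 0))
  have hX := D.scalar_right_angle
  simp only [ρ, map_sub, map_div₀, map_one, cj, cL]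
  field_simp
  linear_combination ((D.u 0 - D.aLast) * (conj (D.u 0) - D.aj 0)
      + (conj (D.u 0) - D.aLast) * (D.u 0 - D.aj 0)) * hX

theorem scalar_ρ_ne_zero : D.ρ 0 ≠ 0 := by
  intro h
  have := D.scalar_norm_ρ
  rw [h] at this
  norm_num at this

/-- In the variable η = ζ/ρ the factor |ρ|² cancels and φ = 1 - 4(1 + η - η̄)/(1 + 4|η|²). This is
Peregrine's quotient at x = Re η, t = Im η / 2; the halving comes from 4x² + 16t² = 4|x + 2it|². -/
theorem scalar_hasPeregrineProfile : HasPeregrineProfile (D.ψ 0) := by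
  have hρ := D.scalar_ρ_ne_zero
  have hρ' : conj (D.ρ 0) ≠ 0 := (map_ne_zero _).2 hρ
  set α : ℂ := Complex.I * D.cLast * D.p (Sum.inl 0) ^ 2 / D.ρ 0 with hα
  set β : ℂ := 2 * Complex.I * D.cLast ^ 2 * D.p (Sum.inl 0) ^ 3 / D.ρ 0 with hβ
  obtain ⟨L, hL⟩ := exists_affineEquiv_re_im_half (α := α) (β := β) (fun x t h => by
    refine D.linear_part_injective (Sum.inl 0) x t ?_
    have e : Complex.I * D.cLast * D.p (Sum.inl 0) ^ 2 * x
        + 2 * Complex.I * D.cLast ^ 2 * D.p (Sum.inl 0) ^ 3 * t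
        = D.ρ 0 * (α * x + β * t) := by
      rw [hα, hβ]
      field_simp
    rw [e, h, mul_zero]) (D.δ (Sum.inl 0) / D.ρ 0)
  refine ⟨D.A 0, L, D.A_pos 0, fun x t => ?_⟩
  rw [norm_ψ, hL]
  congr 1
  set η : ℂ := α * x + β * t - D.δ (Sum.inl 0) / D.ρ 0 with hη
  have hζ : D.ζ x t (Sum.inl 0) = D.ρ 0 * η := by
    rw [hη, hα, hβ, ζ]
    field_simp
  have hun := D.sub_conj_u 0
  have hκ : 1 / (D.u 0 - conj (D.u 0)) ^ 2 = -(D.ρ 0 * conj (D.ρ 0) / 4) := by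
    rw [div_eq_iff (pow_ne_zero _ hun)]
    linear_combination (1 / 4 : ℂ) * D.scalar_norm_ρ
  have hden : (1 + 4 * ((η.re : ℝ) : ℂ) ^ 2 + 16 * (((η.im / 2 : ℝ)) : ℂ) ^ 2)
      = 1 + 4 * (η * conj η) := by
    rw [Complex.mul_conj, Complex.normSq_apply]
    push_cast
    ring
  have hden0 : (1 : ℂ) + 4 * (η * conj η) ≠ 0 := by
    rw [Complex.mul_conj]
    have := Complex.normSq_nonneg η
    have h : (0 : ℝ) < 1 + 4 * Complex.normSq η := by positivity
    have := Complex.ofReal_ne_zero.2 h.ne'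
    push_cast at this
    exact this
  have him : 4 * Complex.I * ((η.im / 2 : ℝ) : ℂ) = η - conj η := by
    rw [Complex.sub_conj]
    push_cast
    ring
  have hφ : D.φ 0 x t = 1 - 4 * (1 + 4 * Complex.I * ((η.im / 2 : ℝ) : ℂ))
      / (1 + 4 * ((η.re : ℝ) : ℂ) ^ 2 + 16 * (((η.im / 2 : ℝ)) : ℂ) ^ 2) := by
    have hG := D.det_G_ne_zero x t
    rw [φ_eq_div, div_eq_iff hG, hden, him, det_G_one, det_shifted_one, hκ, hζ, map_mul,
      one_sub_div hden0, div_mul_eq_mul_div, eq_div_iff hden0]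
    ring
  have hexp : ‖Complex.exp (2 * Complex.I * ((η.im / 2 : ℝ) : ℂ))‖ = 1 := by
    have : 2 * Complex.I * ((η.im / 2 : ℝ) : ℂ) = ((η.im : ℝ) : ℂ) * Complex.I := by
      push_cast
      ring
    rw [this, Complex.norm_exp_ofReal_mul_I]
  rw [peregrine, norm_mul, hexp, mul_one, hφ]

end BreatherData

end Scalar

/-- Data of a two-component breather with the zeros `-3`, `1`, `2`, the poles
`0`, `1 ± 2i` and the critical point `i`. -/
def twoComponentData : BreatherData 2 1 where
  a := ![-3, 1, 2]
  b := ![0, 1 + 2 * Complex.I, 1 - 2 * Complex.I]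
  a_injective := by
    intro i k h
    fin_cases i <;> fin_cases k <;> simp at h ⊢ <;> norm_num at h
  a_ne_b := by
    intro i k h
    have h1 := congrArg Complex.re h
    have h2 := congrArg Complex.im h
    fin_cases i <;> fin_cases k <;> simp at h1 h2
  poles_conj := ⟨Equiv.swap 1 2, fun i => by
    fin_cases i
    · simp [Equiv.swap_apply_of_ne_of_ne]
    · simp [sub_eq_add_neg]
      exact map_ofNat _ 2
    · simp
      exact map_ofNat _ 2⟩
  θ := 0
  d := 0
  u := fun _ => Complex.I
  u_critical := fun _ => by
    have ha : Function.Injective (![-3, 1, 2] : Fin 3 → ℝ) := by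
      intro i k h
      fin_cases i <;> fin_cases k <;> simp at h ⊢ <;> norm_num at h
    have hne : ∀ i, Complex.I ≠ (((![-3, 1, 2] : Fin 3 → ℝ) i : ℝ) : ℂ) := fun i h => by
      simpa using congrArg Complex.im h
    rw [isCriticalPoint_iff ha hne, Fin.sum_univ_three]
    have e0 : (Finset.univ.erase 0 : Finset (Fin 3)) = {1, 2} := by decide
    have e1 : (Finset.univ.erase 1 : Finset (Fin 3)) = {0, 2} := by decide
    have e2 : (Finset.univ.erase 2 : Finset (Fin 3)) = {0, 1} := by decide
    -- The poles are the zeros of 1 - 3/(w + 3) - 1/(w - 1) + 2/(w - 2), whose residues -3, -1, 2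
    -- make i a critical point.
    have r0 : invResidue ![-3, 1, 2] ![0, 1 + 2 * Complex.I, 1 - 2 * Complex.I] 0 = -3 := by
      rw [invResidue_eq_div, e0, Finset.prod_pair (by decide), Fin.prod_univ_three]
      simp
      ring_nf
      norm_num
    have r1 : invResidue ![-3, 1, 2] ![0, 1 + 2 * Complex.I, 1 - 2 * Complex.I] 1 = -1 := by
      rw [invResidue_eq_div, e1, Finset.prod_pair (by decide), Fin.prod_univ_three]
      simp
      ring_nf
      norm_num
    have r2 : invResidue ![-3, 1, 2] ![0, 1 + 2 * Complex.I, 1 - 2 * Complex.I] 2 = 2 := by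
      rw [invResidue_eq_div, e2, Finset.prod_pair (by decide), Fin.prod_univ_three]
      simp
      ring_nf
      norm_num
    rw [r0, r1, r2]
    have h0 := sub_ne_zero.2 (hne 0)
    have h1 := sub_ne_zero.2 (hne 1)
    have h2 := sub_ne_zero.2 (hne 2)
    simp only [cons_val_zero, cons_val_one, cons_val, Complex.ofReal_neg, Complex.ofReal_ofNat,
      Complex.ofReal_one] at h0 h1 h2 ⊢
    field_simp
    ring_nf
    simp
    ring_nf
  uv_injective := by
    intro i k h
    rcases i with i | i <;> rcases k with k | k
    · rw [Subsingleton.elim i k]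
    · have := congrArg Complex.im h
      norm_num at this
    · have := congrArg Complex.im h
      norm_num at this
    · rw [Subsingleton.elim i k]

theorem twoComponentData_not_hasPeregrineProfile :
    ¬ HasPeregrineProfile (twoComponentData.ψ 1) := by
  refine not_hasPeregrineProfile_of_ne_zero
    (twoComponentData.ψ_ne_zero_of_norm_ρ_lt (j := 1) ?_)
  have h : twoComponentData.ρ 1 = 1 / (Complex.I - 1) - 1 / (Complex.I - 2) := by
    simp [BreatherData.ρ, BreatherData.aj, BreatherData.aLast, twoComponentData]
  have hu : (twoComponentData.u 0).im = 1 := Complex.I_im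
  have h1 : Complex.I - 1 ≠ 0 := fun h => by simpa using congrArg Complex.im h
  have h2 : Complex.I - 2 ≠ 0 := fun h => by simpa using congrArg Complex.im h
  -- Hence |ρ|² = 1/10, below the threshold 1/4 for Im u = 1.
  have h3 : 1 / (Complex.I - 1) - 1 / (Complex.I - 2) = -1 / ((Complex.I - 1) * (Complex.I - 2)) := by
    field_simp
    ring
  rw [h, hu, h3, map_div₀, map_mul, Complex.normSq_apply, Complex.normSq_apply,
    Complex.normSq_apply]
  norm_num

end

theorem mainTheorem5 :
    (∀ (n N : ℕ), 1 ≤ N → N ≤ n → ∀ D : BreatherData n N,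
      (∀ w : ℂ, (∀ i, w ≠ (D.a i : ℂ)) →
        (IsCriticalPoint D.a D.b w ↔
          ∑ i, 1 / D.df i * (1 / (w - (D.a i : ℂ)) ^ 2) = 0)) ∧
      (∀ (j : Fin n) (x t : ℝ), (D.K j 0 x t).det ≠ 0) ∧
      IsRationalBreather N D.s D.ψ) ∧
    (∀ D : BreatherData 1 1, D.s 0 = 1 ∧ HasPeregrineProfile (D.ψ 0)) ∧
    (∃ n : ℕ, 2 ≤ n ∧ ∃ (D : BreatherData n 1) (j : Fin n),
      ¬ HasPeregrineProfile (D.ψ j)) :=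
  ⟨fun _ _ hN _ D => ⟨fun _ hw => D.isCriticalPoint_iff_sum hw, D.det_K_zero_ne_zero,
      D.isRationalBreather hN⟩,
    fun D => ⟨D.scalar_sign, D.scalar_hasPeregrineProfile⟩,
    ⟨2, le_rfl, twoComponentData, 1, twoComponentData_not_hasPeregrineProfile⟩⟩
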